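/- Let $n\ge 1$ and $\mathbb H_{\mathbb C}^{n+1}=\{Z=(z_1,\dots,z_{n+1})\in\mathbb C^{n+1}:\operatorname{Im}z_{n+1}>\sum_{j=1}^n|z_j|^2\}$, with $t(Z)=\operatorname{Re}z_{n+1}$, $\beta(Z)=\sum_{j=1}^n|z_j|^2$, $\rho(Z)=\operatorname{Im}z_{n+1}-\beta(Z)$. Let $G(\mathbb Z)$ be the group of block diagonal matrices $\gamma=\mathrm{diag}\big(\sigma,\begin{pmatrix}a&b\\c&d\end{pmatrix}\big)$ with $\sigma$ an $n\times n$ permutation matrix and $\begin{pmatrix}a&b\\c&d\end{pmatrix}\in SL(2,\mathbb Z)$, acting by $$\gamma(Z)=\Big(\frac{\sigma(z_1,\dots,z_n)}{cz_{n+1}+d},\frac{az_{n+1}+b}{cz_{n+1}+d}\Big),$$ and let $G(\mathbb Z)_\infty$ be its subgroup given by $c=0$. For $s\in\mathbb C$ and $\mu\in\{0,1-n\}$ put $$E(Z;s,\mu)=\sum_{\gamma\in G(\mathbb Z)_\infty\backslash G(\mathbb Z)}\rho(\gamma(Z))^s\beta(\gamma(Z))^\mu .$$ Write $e(x)=e^{2\pi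 ix}$, $(\alpha,k)=\alpha(\alpha+1)\cdots(\alpha+k-1)$, $\delta_{0,m}$ for the Kronecker symbol, $$\varphi_m(s)=\sum_{c>0}\frac1{c^{2s}}\sum_{\substack{d\bmod c\\(d,c)=1}}e\Big(\frac{md}{c}\Big),\quad G(z)=\sum_{k=0}^\infty\frac1{2^kk!}\binom{2k}{k}z^k,\quad H(z)=\sum_{k=n-1}^\infty\frac{2^k(1-\frac n2,k)}{k!(k-n+1)!}z^k,$$ $$K_\nu(x)=\tfrac12\int_0^\infty e^{-\frac x2(t+\frac1t)}t^{\nu-1}dt\quad(x>0),$$ and let $W_{\kappa,\mu}$ be the Whittaker function, given for $x>0$ and $\operatorname{Re}(\frac12-\kappa+\mu)>0$ by $$W_{\kappa,\mu}(x)=\frac{e^{-x/2}x^{\mu+\frac12}}{\Gamma(\frac12-\kappa+\mu)}\int_0^\infty e^{-xt}t^{-\frac12-\kappa+\mu}(1+t)^{-\frac12+\kappa+\mu}dt .$$ (1) Let $\operatorname{Re}(s)>1$. The series $E(Z;s,0)$ and $\varphi_m(s)$ ($m\in\mathbb Z$) converge absolutely. The Fourier coefficient of $E(Z;s,0)$,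 $$\int_0^1E\big((z_1,\dots,z_n,t+i(\rho+\beta));s,0\big)e(-mt)\,dt,\qquad \beta=\sum_{j=1}^n|z_j|^2,\ \rho>0,$$ depends only on $m,\rho,\beta$; call it $a_m(\rho,\beta)$. Then $E(Z;s,0)=\sum_{m\in\mathbb Z}a_m(\rho,\beta)e^{2\pi imt}$, with absolute convergence. For $\rho>0$ let $$a_m(\rho)=\int_{(0,\infty)^n}[a_m(\rho,\beta)-\delta_{0,m}\rho^s]\prod_{j=1}^ne^{-2\pi|m|\beta_j}G(2\pi|m|\beta_j)\,d\beta_1\cdots d\beta_n,\qquad\beta=\beta_1+\dots+\beta_n .$$ If $m\ne0$ and $\operatorname{Re}(s)>\frac n2$, this integral converges absolutely and $$a_m(\rho)=2^{1-n}\pi^{s-\frac n2}\frac{\Gamma(s-\frac n2)}{\Gamma(s)^2}\varphi_m(s)|m|^{s-\frac{n+1}2}\rho^{\frac{n+1}2}K_{s-\frac{n+1}2}(2\pi|m|\rho).$$ If $m=0$ and $\operatorname{Re}(s)>\frac{n+1}2$, it converges absolutely and $$a_0(\rho)=2^{-n}\sqrt\pi\,\frac{\Gamma(s-\frac n2)\Gamma(s-\frac{n+1}2)}{\Gamma(s)^2}\varphi_0(s)\rho^{n+1-s}.$$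 (2) Let $\operatorname{Re}(s)>n$. For $n\ge2$ consider only points with $(z_1,\dots,z_n)\ne0$. The series $E(Z;s,1-n)$ and $\varphi_m(s-n+1)$ ($m\in\mathbb Z$) converge absolutely. The Fourier coefficient $\int_0^1E\big((z_1,\dots,z_n,t+i(\rho+\beta));s,1-n\big)e(-mt)\,dt$ depends only on $m,\rho,\beta$; call it $b_m(\rho,\beta)$. Then $E(Z;s,1-n)=\sum_{m\in\mathbb Z}b_m(\rho,\beta)e^{2\pi imt}$, with absolute convergence. For every $m\ne0$ and $\rho>0$ the integral $$b_m(\rho)=\int_0^\infty b_m(\rho,\beta)e^{-2\pi|m|\beta}H(2\pi|m|\beta)\,d\beta$$ converges absolutely, and $$b_m(\rho)=2^{n-1}\pi^{s-\frac n2}\frac{\Gamma(s-\frac n2)}{\Gamma(s-n+1)^2}\varphi_m(s-n+1)|m|^{s-\frac{n+1}2}\rho^{\frac{n+1}2}K_{s-\frac{n+1}2}(2\pi|m|\rho)-R(|m|,\rho),$$ where $$R(|m|,\rho)=2^{n-2}\pi^{s-\frac n2}\Gamma(s-n+1)^{-1}\varphi_m(s-n+1)|m|^{s-1-\frac n2}\rho^{\frac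 n2}\sum_{k=0}^{n-2}\frac{(1-\frac n2,k)}{k!}(4\pi|m|\rho)^{\frac k2}W_{\frac n2-1-\frac k2,\,s-\frac{n+1}2-\frac k2}(4\pi|m|\rho)$$ (the sum is empty for $n=1$). -/

import Mathlib

open scoped BigOperators MatrixGroups
open MeasureTheory Set

namespace UnitaryEisenstein

noncomputable section

/-! ### The Siegel domain of the second kind -/

/-- The complex hyperbolic space `{(z₁, …, zₙ, zₙ₊₁) ∈ ℂⁿ⁺¹ : Im zₙ₊₁ > ∑ |zⱼ|²}`;
`z` collects the first `n` coordinates and `w` is the last coordinate `zₙ₊₁`. -/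
@[ext]
structure SiegelDomain (n : ℕ) where
  z : Fin n → ℂ
  w : ℂ
  sum_lt : ∑ j, Complex.normSq (z j) < w.im

variable {n : ℕ}

/-- `β(Z) = ∑ |zⱼ|²`. -/
def beta (Z : SiegelDomain n) : ℝ := ∑ j, Complex.normSq (Z.z j)

/-- `ρ(Z) = Im zₙ₊₁ - ∑ |zⱼ|²`. -/
def rho (Z : SiegelDomain n) : ℝ := Z.w.im - ∑ j, Complex.normSq (Z.z j)

/-- `t(Z) = Re zₙ₊₁`. -/
def tt (Z : SiegelDomain n) : ℝ := Z.w.re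

/-- The point with coordinates `(z, t, ρ)`, that is `zₙ₊₁ = t + i (ρ + ∑ |zⱼ|²)`. -/
def ofCoords (z : Fin n → ℂ) (t ρ : ℝ) (hρ : 0 < ρ) : SiegelDomain n where
  z := z
  w := ⟨t, ρ + ∑ j, Complex.normSq (z j)⟩
  sum_lt := by simpa using hρ

theorem SiegelDomain.im_pos (Z : SiegelDomain n) : 0 < Z.w.im :=
  lt_of_le_of_lt (Finset.sum_nonneg fun _ _ => Complex.normSq_nonneg _) Z.sum_lt

/-! ### The modular group and its action -/

/-- The group of block diagonal matrices `diag(σ, g)` with `σ` an `n × n` permutation matrix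
and `g ∈ SL(2, ℤ)`: the direct product of the symmetric group and `SL(2, ℤ)`. -/
abbrev ModularGroup (n : ℕ) : Type := Equiv.Perm (Fin n) × SL(2, ℤ)

/-- `c w + d` for `g = (a b; c d)`. -/
def mobDen (g : SL(2, ℤ)) (w : ℂ) : ℂ := (g 1 0 : ℂ) * w + (g 1 1 : ℂ)

/-- `a w + b` for `g = (a b; c d)`. -/
def mobNum (g : SL(2, ℤ)) (w : ℂ) : ℂ := (g 0 0 : ℂ) * w + (g 0 1 : ℂ)

theorem den_ne_zero (g : SL(2, ℤ)) {w : ℂ} (hw : 0 < w.im) : mobDen g w ≠ 0 := by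
  intro h
  have h1 := congrArg Complex.im h
  have h2 := congrArg Complex.re h
  simp [mobDen] at h1 h2
  have hdet := g.det_coe
  rw [Matrix.det_fin_two] at hdet
  rcases h1 with h1 | h1
  · rw [h1] at h2 hdet
    simp at h2
    rw [h2] at hdet
    simp at hdet
  · exact hw.ne' h1

theorem im_num_div_den (g : SL(2, ℤ)) {w : ℂ} (hw : 0 < w.im) :
    (mobNum g w / mobDen g w).im = w.im / Complex.normSq (mobDen g w) := by
  have hN : Complex.normSq (mobDen g w) ≠ 0 := by simpa using den_ne_zero g hw
  have hdet : ((g 0 0 : ℤ) : ℝ) * (g 1 1 : ℤ) - ((g 0 1 : ℤ) : ℝ) * (g 1 0 : ℤ) = 1 := by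
    have h := g.det_coe
    rw [Matrix.det_fin_two] at h
    exact_mod_cast h
  rw [Complex.div_im, ← sub_div]
  congr 1
  simp [mobNum, mobDen]
  linear_combination w.im * hdet

theorem den_mul (g h : SL(2, ℤ)) {w : ℂ} (hw : 0 < w.im) :
    mobDen (g * h) w = mobDen g (mobNum h w / mobDen h w) * mobDen h w := by
  have h0 := den_ne_zero h hw
  rw [mobDen, mobDen, add_mul, mul_assoc, div_mul_cancel₀ _ h0]
  simp [mobNum, mobDen, Matrix.mul_apply, Fin.sum_univ_two]
  ring

theorem num_mul (g h : SL(2, ℤ)) {w : ℂ} (hw : 0 < w.im) :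
    mobNum (g * h) w = mobNum g (mobNum h w / mobDen h w) * mobDen h w := by
  have h0 := den_ne_zero h hw
  rw [mobNum, mobNum, add_mul, mul_assoc, div_mul_cancel₀ _ h0]
  simp [mobNum, mobDen, Matrix.mul_apply, Fin.sum_univ_two]
  ring

theorem sum_normSq_act (γ : ModularGroup n) (Z : SiegelDomain n) :
    ∑ j, Complex.normSq (Z.z (γ.1⁻¹ j) / mobDen γ.2 Z.w) =
      (∑ j, Complex.normSq (Z.z j)) / Complex.normSq (mobDen γ.2 Z.w) := by
  simp only [map_div₀, ← Finset.sum_div]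
  congr 1
  exact Equiv.sum_comp (γ.1⁻¹) (fun j => Complex.normSq (Z.z j))

/-- `diag(σ, (a b; c d))` sends `(z, zₙ₊₁)` to
`(σ(z) / (c zₙ₊₁ + d), (a zₙ₊₁ + b) / (c zₙ₊₁ + d))`; the coordinates are permuted through
`σ⁻¹`, so that this is a left action. -/
def act (γ : ModularGroup n) (Z : SiegelDomain n) : SiegelDomain n where
  z := fun j => Z.z (γ.1⁻¹ j) / mobDen γ.2 Z.w
  w := mobNum γ.2 Z.w / mobDen γ.2 Z.w
  sum_lt := by
    rw [im_num_div_den _ Z.im_pos, sum_normSq_act]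
    exact div_lt_div_of_pos_right Z.sum_lt
      (Complex.normSq_pos.mpr (den_ne_zero _ Z.im_pos))

instance : MulAction (ModularGroup n) (SiegelDomain n) where
  smul := act
  one_smul Z := by
    change act 1 Z = Z
    ext <;> simp [act, mobDen, mobNum]
  mul_smul γ δ Z := by
    change act (γ * δ) Z = act γ (act δ Z)
    have h0 := den_ne_zero δ.2 Z.im_pos
    have e1 := den_mul γ.2 δ.2 Z.im_pos
    have e2 := num_mul γ.2 δ.2 Z.im_pos
    ext
    · simp only [act, Prod.fst_mul, Prod.snd_mul, e1, mul_inv_rev, Equiv.Perm.mul_apply]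
      rw [div_div, mul_comm (mobDen δ.2 Z.w)]
    · simp only [act, Prod.snd_mul, e1, e2]
      rw [mul_div_mul_right _ _ h0]

theorem beta_smul (γ : ModularGroup n) (Z : SiegelDomain n) :
    beta (γ • Z) = beta Z / Complex.normSq (mobDen γ.2 Z.w) := sum_normSq_act γ Z

theorem rho_smul (γ : ModularGroup n) (Z : SiegelDomain n) :
    rho (γ • Z) = rho Z / Complex.normSq (mobDen γ.2 Z.w) := by
  change (mobNum γ.2 Z.w / mobDen γ.2 Z.w).im -
    ∑ j, Complex.normSq (Z.z (γ.1⁻¹ j) / mobDen γ.2 Z.w) = _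
  rw [im_num_div_den _ Z.im_pos, sum_normSq_act, rho, sub_div]

/-- The parabolic subgroup of all `diag(σ, (±1 k; 0 ±1))`, `k ∈ ℤ`: lower left entry `0`. -/
def parabolic (n : ℕ) : Subgroup (ModularGroup n) where
  carrier := {γ | γ.2 1 0 = 0}
  one_mem' := by simp
  mul_mem' {γ δ} hγ hδ := by
    simp only [mem_ofPred_eq] at hγ hδ ⊢
    simp [Matrix.mul_apply, Fin.sum_univ_two, hγ, hδ]
  inv_mem' {γ} hγ := by
    simp only [mem_ofPred_eq] at hγ ⊢
    simp [Matrix.SpecialLinearGroup.coe_inv, Matrix.adjugate_fin_two, hγ]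

theorem normSq_den_of_mem {h : ModularGroup n} (hh : h ∈ parabolic n) (w : ℂ) :
    Complex.normSq (mobDen h.2 w) = 1 := by
  have h0 : h.2 1 0 = 0 := hh
  have hdet := h.2.det_coe
  rw [Matrix.det_fin_two, h0, mul_zero, sub_zero] at hdet
  rcases Int.eq_one_or_neg_one_of_mul_eq_one' hdet with h1 | h1 <;> simp [mobDen, h0, h1.2]

/-! ### The Eisenstein series -/

/-- `φ_{λ, μ}(Z) = ρ(Z)^λ β(Z)^μ`. -/
def phi (lam mu : ℂ) (Z : SiegelDomain n) : ℂ := (rho Z : ℂ) ^ lam * (beta Z : ℂ) ^ mu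

theorem phi_parabolic_smul (lam mu : ℂ) {h : ModularGroup n} (hh : h ∈ parabolic n)
    (Z : SiegelDomain n) : phi lam mu (h • Z) = phi lam mu Z := by
  simp [phi, rho_smul, beta_smul, normSq_den_of_mem hh]

/-- The coset space `G(ℤ)_∞ \ G(ℤ)` of the cosets `G(ℤ)_∞ γ`. -/
abbrev Cosets (n : ℕ) : Type := Quotient (QuotientGroup.rightRel (parabolic n))

/-- The term `φ_{λ, μ}(γ Z)`, as a function of the coset of `γ`. -/
def eisTerm (lam mu : ℂ) (Z : SiegelDomain n) : Cosets n → ℂ :=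
  Quotient.lift (fun γ : ModularGroup n => phi lam mu (γ • Z)) (by
    intro γ δ hγδ
    have h := QuotientGroup.rightRel_apply.mp hγδ
    have e := phi_parabolic_smul lam mu h (γ • Z)
    rw [← mul_smul, inv_mul_cancel_right] at e
    exact e.symm)

/-- `E(Z; λ, μ) = ∑_{γ ∈ G(ℤ)_∞ \ G(ℤ)} ρ(γ Z)^λ β(γ Z)^μ`. -/
def eisenstein (lam mu : ℂ) (Z : SiegelDomain n) : ℂ := ∑' q : Cosets n, eisTerm lam mu Z q

/-- `e(x) = exp(2 π i x)`. -/
def e (x : ℝ) : ℂ := Complex.exp (2 * Real.pi * Complex.I * x)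

/-! ### Special functions -/

/-- `K_ν(x) = ½ ∫₀^∞ exp(-(x/2)(t + 1/t)) t^{ν-1} dt`, for `x > 0`. -/
def besselK (ν : ℂ) (x : ℝ) : ℂ :=
  (1 / 2) * ∫ t in Ioi (0 : ℝ), (Real.exp (-(x / 2) * (t + 1 / t)) : ℂ) * (t : ℂ) ^ (ν - 1)

/-- Tricomi's function `Ψ(a, c; x) = Γ(a)⁻¹ ∫₀^∞ e^{-xt} t^{a-1} (1+t)^{c-a-1} dt`,
for `Re a > 0` and `x > 0`. -/
def tricomiPsi (a c : ℂ) (x : ℝ) : ℂ :=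
  (Complex.Gamma a)⁻¹ * ∫ t in Ioi (0 : ℝ),
    (Real.exp (-(x * t)) : ℂ) * (t : ℂ) ^ (a - 1) * ((1 + t : ℝ) : ℂ) ^ (c - a - 1)

/-- Whittaker's function `W_{κ, μ}(x) = e^{-x/2} x^{c/2} Ψ(a, c; x)` with `a = ½ - κ + μ` and
`c = 2μ + 1`, for `x > 0` and `Re (½ - κ + μ) > 0`. -/
def whittakerW (κ μ : ℂ) (x : ℝ) : ℂ :=
  (Real.exp (-x / 2) : ℂ) * (x : ℂ) ^ ((2 * μ + 1) / 2) *
    tricomiPsi (1 / 2 - κ + μ) (2 * μ + 1) x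

/-- `(α, k) = α (α + 1) ⋯ (α + k - 1)`. -/
def poch (α : ℝ) (k : ℕ) : ℝ := ∏ i ∈ Finset.range k, (α + i)

/-- `G(z) = ∑_{k ≥ 0} (2k choose k) z^k / (2^k k!)`. -/
def seriesG (z : ℝ) : ℝ := ∑' k : ℕ, 1 / (2 ^ k * (k.factorial : ℝ)) * ((2 * k).choose k : ℝ) * z ^ k

/-- `H(z) = ∑_{k ≥ n-1} 2^k (1 - n/2, k) z^k / (k! (k-n+1)!)`, for `n ≥ 1`, where
the summation index is `k = j + (n - 1)`, `j ≥ 0`. -/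
def seriesH (n : ℕ) (z : ℝ) : ℝ :=
  ∑' j : ℕ, 2 ^ (j + (n - 1)) * poch (1 - n / 2) (j + (n - 1)) /
    (((j + (n - 1)).factorial : ℝ) * (j.factorial : ℝ)) * z ^ (j + (n - 1))

/-- The summand `c^{-2s} ∑_{d mod c, (d, c) = 1} e(m d / c)` of `φ_m(s)`. -/
def varphiTerm (m : ℤ) (s : ℂ) (c : ℕ+) : ℂ :=
  1 / (((c : ℕ) : ℂ) ^ (2 * s)) *
    ∑ d ∈ (Finset.range c).filter (fun d => Nat.Coprime d c), e (m * d / (c : ℕ))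

/-- `φ_m(s) = ∑_{c > 0} c^{-2s} ∑_{d mod c, (d, c) = 1} e(m d / c)`. -/
def varphi (m : ℤ) (s : ℂ) : ℂ := ∑' c : ℕ+, varphiTerm m s c

/-! ### The integral transforms -/

/-- The integrand `[a_m(ρ, β) - δ_{0,m} ρ^s] ∏ e^{-2π|m|βⱼ} G(2π|m|βⱼ)` at `β = β₁ + ⋯ + βₙ`,
for a given coefficient function `a : m ↦ ρ ↦ β ↦ a_m(ρ, β)`. -/
def integrandA (a : ℤ → ℝ → ℝ → ℂ) (s : ℂ) (m : ℤ) (ρ : ℝ) (b : Fin n → ℝ) : ℂ :=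
  (a m ρ (∑ j, b j) - if m = 0 then (ρ : ℂ) ^ s else 0) *
    ∏ j, ((Real.exp (-(2 * Real.pi * |(m : ℝ)| * b j)) * seriesG (2 * Real.pi * |(m : ℝ)| * b j) : ℝ) : ℂ)

/-- The integrand `b_m(ρ, β) e^{-2π|m|β} H(2π|m|β)`, for a given coefficient function
`b : m ↦ ρ ↦ β ↦ b_m(ρ, β)`. -/
def integrandB (n : ℕ) (b : ℤ → ℝ → ℝ → ℂ) (m : ℤ) (ρ β : ℝ) : ℂ :=
  b m ρ β *
    ((Real.exp (-(2 * Real.pi * |(m : ℝ)| * β)) * seriesH n (2 * Real.pi * |(m : ℝ)| * β) : ℝ) : ℂ)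

/-- `R(M, ρ)` for `M = |m|`:
`2^{n-2} π^{s-n/2} Γ(s-n+1)⁻¹ φ_m(s-n+1) |m|^{s-1-n/2} ρ^{n/2} ∑_{k=0}^{n-2} (1-n/2, k)/k! ·`
`(4π|m|ρ)^{k/2} W_{n/2-1-k/2, s-(n+1)/2-k/2}(4π|m|ρ)`; the sum is empty for `n = 1`. -/
def remainderR (n : ℕ) (s : ℂ) (m : ℤ) (ρ : ℝ) : ℂ :=
  (2 : ℂ) ^ ((n : ℤ) - 2) * (Real.pi : ℂ) ^ (s - n / 2) * (Complex.Gamma (s - n + 1))⁻¹ *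
    varphi m (s - n + 1) * ((|(m : ℝ)| : ℝ) : ℂ) ^ (s - 1 - n / 2) * (ρ : ℂ) ^ ((n : ℂ) / 2) *
    ∑ k ∈ Finset.range (n - 1),
      (poch (1 - n / 2) k / (k.factorial : ℝ) : ℝ) *
        ((4 * Real.pi * |(m : ℝ)| * ρ : ℝ) : ℂ) ^ ((k : ℂ) / 2) *
        whittakerW (n / 2 - 1 - k / 2) (s - (n + 1) / 2 - k / 2) (4 * Real.pi * |(m : ℝ)| * ρ)

end

end UnitaryEisenstein

open UnitaryEisenstein

namespace UnitaryEisenstein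

/-! Put κ = λ + μ, y = ρ + β, M = 2π|m|. Since ρ and β are both divided by |cw + d|² under the
group, the series is ρ^λ β^μ times a sum of |cw + d|^{-2κ} over coprime rows (c, d) up to sign. The
row (0, 1) gives the Kronecker term. For c > 0, writing the second entry as d + cq with d mod c and
applying Poisson summation in q to (t² + y²)^{-κ} produces φ_m(κ) times the Fourier transform of
this function at m (`hasSum_tsum_rowTerm`, `hasSum_eisCoeff`).

The Fourier transform is a Bessel integral, but the decisive form is Basset's: up to constants it
equals ∫_M^∞ e^{-yv} (v² - M²)^{κ-1} dv (`laplaceKernel_eq`). There β occurs only in e^{-βv}, so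
integrating the coefficient against a weight in β inserts the Laplace transform of that weight under
the v-integral (`integral_laplaceKernel_mul`).

The weights G and H are made for this. Termwise integration yields a binomial series in 2M/(v + M)
(`laplace_weight`). For G the transform is (v² - M²)^{-1/2}, so n factors lower κ = s to s - n/2.
For H, after β^{n-1} has cancelled β^{1-n}, the binomial series lacks its first n - 1 terms: the
full series (v² - M²)^{n/2-1} raises κ = s - n + 1 to s - n/2, and the missing terms are Tricomi
integrals, which make up R. The shifted kernel is a K-Bessel function for m ≠ 0; for m = 0 it is a
Gamma integral, rewritten by Legendre duplication. -/

/-- Fubini's theorem in the form used below: integrability of the sections in the first variable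
and of their `L¹` norms gives integrability and the exchange of the iterated integrals. -/
theorem integrable_integral_and_swap {α β : Type*} [MeasurableSpace α] [MeasurableSpace β]
    {μ : Measure α} {ν : Measure β} [SFinite μ] [SFinite ν] {F : α → β → ℂ}
    (hF : AEStronglyMeasurable (Function.uncurry F) (μ.prod ν))
    (h1 : ∀ᵐ y ∂ν, Integrable (fun x => F x y) μ)
    (h2 : Integrable (fun y => ∫ x, ‖F x y‖ ∂μ) ν) :
    Integrable (fun x => ∫ y, F x y ∂ν) μ ∧
      ∫ x, ∫ y, F x y ∂ν ∂μ = ∫ y, ∫ x, F x y ∂μ ∂ν := by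
  have h : Integrable (Function.uncurry F) (μ.prod ν) :=
    (integrable_prod_iff' hF).mpr ⟨h1, h2⟩
  exact ⟨h.integral_prod_left, integral_integral_swap h⟩

/-! ### The subordination integral by the Cauchy–Schlömilch substitution. -/

section Subordination

/-- Completing the square: up to the constant vy, the exponent of the subordination integral is a
Gaussian in u = y√τ - v/(2√τ). -/
theorem cauchySchlomilch_sq {v y τ : ℝ} (hτ : 0 < τ) :
    (y * τ ^ (1 / 2 : ℝ) - v / 2 * τ ^ (-1 / 2 : ℝ)) ^ 2 =
      τ * y ^ 2 + v ^ 2 / (4 * τ) - v * y := by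
  have h : τ ^ (-1 / 2 : ℝ) = (τ ^ (1 / 2 : ℝ))⁻¹ := by
    rw [← Real.rpow_neg hτ.le]; norm_num
  have h2 : (τ ^ (1 / 2 : ℝ)) ^ 2 = τ := by
    rw [← Real.rpow_natCast, ← Real.rpow_mul hτ.le]; norm_num
  have h3 : 0 < τ ^ (1 / 2 : ℝ) := Real.rpow_pos_of_pos hτ _
  rw [h]
  generalize τ ^ (1 / 2 : ℝ) = x at *
  rw [← h2]
  field_simp
  ring

theorem cauchySchlomilch_hasDerivAt (v y : ℝ) {τ : ℝ} (hτ : 0 < τ) :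
    HasDerivAt (fun τ : ℝ => y * τ ^ (1 / 2 : ℝ) - v / 2 * τ ^ (-1 / 2 : ℝ))
      (y / 2 * τ ^ (-1 / 2 : ℝ) + v / 4 * τ ^ (-3 / 2 : ℝ)) τ := by
  have h1 := (Real.hasDerivAt_rpow_const (x := τ) (p := 1 / 2) (Or.inl hτ.ne')).const_mul y
  have h2 := (Real.hasDerivAt_rpow_const (x := τ) (p := -1 / 2) (Or.inl hτ.ne')).const_mul (v / 2)
  refine (h1.fun_sub h2).congr_deriv ?_
  rw [show (1 / 2 - 1 : ℝ) = -1 / 2 by norm_num, show (-1 / 2 - 1 : ℝ) = -3 / 2 by norm_num]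
  ring

theorem cauchySchlomilch_strictMonoOn {v y : ℝ} (hv : 0 < v) (hy : 0 < y) :
    StrictMonoOn (fun τ : ℝ => y * τ ^ (1 / 2 : ℝ) - v / 2 * τ ^ (-1 / 2 : ℝ)) (Ioi 0) := by
  intro a ha b hb hab
  have ha' : (0 : ℝ) < a := ha
  have h1 : a ^ (1 / 2 : ℝ) < b ^ (1 / 2 : ℝ) := Real.rpow_lt_rpow ha'.le hab (by norm_num)
  have h2 : b ^ (-1 / 2 : ℝ) < a ^ (-1 / 2 : ℝ) :=
    Real.rpow_lt_rpow_of_neg ha' hab (by norm_num)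
  have := mul_lt_mul_of_pos_left h1 hy
  have := mul_lt_mul_of_pos_left h2 (half_pos hv)
  simp only
  linarith

theorem cauchySchlomilch_image {v y : ℝ} (hv : 0 < v) (hy : 0 < y) :
    (fun τ : ℝ => y * τ ^ (1 / 2 : ℝ) - v / 2 * τ ^ (-1 / 2 : ℝ)) '' Ioi 0 = univ := by
  refine eq_univ_of_forall fun u => ?_
  have hvy : 0 < v * y := mul_pos hv hy
  -- With x = √τ the equation y x - v/(2x) = u is 2y x² - 2u x - v = 0, whose positive root is (u +
  -- r)/(2y).
  set r := Real.sqrt (u ^ 2 + 2 * (v * y)) with hr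
  have hr2 : r ^ 2 = u ^ 2 + 2 * (v * y) := Real.sq_sqrt (by positivity)
  have hlt : |u| < r := by
    rw [hr, ← Real.sqrt_sq_eq_abs]
    exact Real.sqrt_lt_sqrt (sq_nonneg u) (by linarith)
  have hx : 0 < (u + r) / (2 * y) := by
    have := neg_abs_le u
    have : 0 < u + r := by linarith
    positivity
  set x := (u + r) / (2 * y) with hxdef
  refine ⟨x ^ 2, by simp only [mem_Ioi]; positivity, ?_⟩
  have e1 : (x ^ 2) ^ (1 / 2 : ℝ) = x := by
    rw [← Real.rpow_natCast, ← Real.rpow_mul hx.le]; norm_num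
  have e2 : (x ^ 2) ^ (-1 / 2 : ℝ) = x⁻¹ := by
    rw [← Real.rpow_natCast, ← Real.rpow_mul hx.le]
    norm_num
    rw [Real.rpow_neg_one]
  simp only [e1, e2]
  have hr' : r = 2 * y * x - u := by rw [hxdef]; field_simp; ring
  rw [hr'] at hr2
  field_simp
  nlinarith

/-- The subordination formula for `e^{-vy}`. -/
theorem integral_subordination {v y : ℝ} (hv : 0 < v) (hy : 0 < y) :
    IntegrableOn (fun τ : ℝ => τ ^ (-3 / 2 : ℝ) * Real.exp (-(τ * y ^ 2) - v ^ 2 / (4 * τ)))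
      (Ioi 0) ∧
    ∫ τ in Ioi (0 : ℝ), τ ^ (-3 / 2 : ℝ) * Real.exp (-(τ * y ^ 2) - v ^ 2 / (4 * τ)) =
      2 * Real.sqrt Real.pi / v * Real.exp (-(v * y)) := by
  set E : ℝ → ℝ := fun τ => Real.exp (-(τ * y ^ 2) - v ^ 2 / (4 * τ)) with hE
  set φ : ℝ → ℝ := fun τ : ℝ => y * τ ^ (1 / 2 : ℝ) - v / 2 * τ ^ (-1 / 2 : ℝ) with hφ
  set ψ : ℝ → ℝ := fun τ : ℝ => y / 2 * τ ^ (-1 / 2 : ℝ) + v / 4 * τ ^ (-3 / 2 : ℝ) with hψ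
  have hd : ∀ τ ∈ Ioi (0 : ℝ), HasDerivWithinAt φ (ψ τ) (Ioi 0) τ := fun τ hτ =>
    (cauchySchlomilch_hasDerivAt v y hτ).hasDerivWithinAt
  have hinj := (cauchySchlomilch_strictMonoOn hv hy).injOn
  -- The Jacobian of u has two terms, so the Gaussian integral becomes a combination of the
  -- integrals with τ^{-1/2} and τ^{-3/2}.
  have hcongr : ∀ τ ∈ Ioi (0 : ℝ), |ψ τ| • Real.exp (-1 * φ τ ^ 2) =
      Real.exp (v * y) * (y / 2 * (τ ^ (-1 / 2 : ℝ) * E τ) + v / 4 * (τ ^ (-3 / 2 : ℝ) * E τ)) := by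
    intro τ hτ
    have hτ' : (0 : ℝ) < τ := hτ
    have hpos : 0 < ψ τ := by simp only [hψ]; positivity
    have : Real.exp (-1 * φ τ ^ 2) = Real.exp (v * y) * E τ := by
      simp only [hφ, hE]
      rw [cauchySchlomilch_sq hτ', ← Real.exp_add]
      ring_nf
    rw [abs_of_pos hpos, smul_eq_mul, this]
    simp only [hψ]
    ring
  have hint : IntegrableOn (fun τ => Real.exp (v * y) *
      (y / 2 * (τ ^ (-1 / 2 : ℝ) * E τ) + v / 4 * (τ ^ (-3 / 2 : ℝ) * E τ))) (Ioi 0) := by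
    rw [← integrableOn_congr_fun hcongr measurableSet_Ioi,
      ← integrableOn_image_iff_integrableOn_abs_deriv_smul measurableSet_Ioi hd hinj
        (fun u => Real.exp (-1 * u ^ 2)), cauchySchlomilch_image hv hy]
    exact (integrable_exp_neg_mul_sq one_pos).integrableOn
  have hval : ∫ τ in Ioi (0 : ℝ), Real.exp (v * y) *
      (y / 2 * (τ ^ (-1 / 2 : ℝ) * E τ) + v / 4 * (τ ^ (-3 / 2 : ℝ) * E τ)) =
      Real.sqrt Real.pi := by
    rw [← setIntegral_congr_fun measurableSet_Ioi hcongr,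
      ← integral_image_eq_integral_abs_deriv_smul measurableSet_Ioi hd hinj
        (fun u => Real.exp (-1 * u ^ 2)), cauchySchlomilch_image hv hy, setIntegral_univ,
        integral_gaussian]
    simp
  have hmeas : ∀ p : ℝ, AEStronglyMeasurable (fun τ : ℝ => τ ^ p * E τ)
      (volume.restrict (Ioi 0)) := fun p => by
    simp only [hE]
    exact Measurable.aestronglyMeasurable (by fun_prop)
  have hint' : IntegrableOn (fun τ =>
      (y / 2 * (τ ^ (-1 / 2 : ℝ) * E τ) + v / 4 * (τ ^ (-3 / 2 : ℝ) * E τ))) (Ioi 0) := by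
    refine (hint.const_mul (Real.exp (v * y))⁻¹).congr (Filter.Eventually.of_forall fun τ => ?_)
    simp only
    rw [inv_mul_cancel_left₀ (Real.exp_pos _).ne']
  have hEpos : ∀ τ, 0 < E τ := fun τ => Real.exp_pos _
  -- Both terms of the combination are nonnegative, so each is dominated by their sum.
  have i2 : IntegrableOn (fun τ : ℝ => τ ^ (-3 / 2 : ℝ) * E τ) (Ioi 0) := by
    refine (hint'.const_mul (4 / v)).mono' (hmeas _) ?_
    refine (ae_restrict_iff' measurableSet_Ioi).mpr (Filter.Eventually.of_forall fun τ hτ => ?_)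
    have hτ' : (0 : ℝ) < τ := hτ
    have := hEpos τ
    rw [Real.norm_of_nonneg (by positivity)]
    have : 0 ≤ 4 / v * (y / 2 * (τ ^ (-1 / 2 : ℝ) * E τ)) := by positivity
    have e : 4 / v * (v / 4 * (τ ^ (-3 / 2 : ℝ) * E τ)) = τ ^ (-3 / 2 : ℝ) * E τ := by
      field_simp
    linarith
  have i1 : IntegrableOn (fun τ : ℝ => τ ^ (-1 / 2 : ℝ) * E τ) (Ioi 0) := by
    refine (hint'.const_mul (2 / y)).mono' (hmeas _) ?_
    refine (ae_restrict_iff' measurableSet_Ioi).mpr (Filter.Eventually.of_forall fun τ hτ => ?_)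
    have hτ' : (0 : ℝ) < τ := hτ
    have := hEpos τ
    rw [Real.norm_of_nonneg (by positivity)]
    have : 0 ≤ 2 / y * (v / 4 * (τ ^ (-3 / 2 : ℝ) * E τ)) := by positivity
    have e : 2 / y * (y / 2 * (τ ^ (-1 / 2 : ℝ) * E τ)) = τ ^ (-1 / 2 : ℝ) * E τ := by
      field_simp
    linarith
  -- The inversion τ ↦ c/τ with c = v²/(4y²) preserves E and exchanges the two powers; the two terms
  -- therefore contribute equally to √π.
  have hrel : ∫ τ in Ioi (0 : ℝ), τ ^ (-1 / 2 : ℝ) * E τ =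
      v / (2 * y) * ∫ τ in Ioi (0 : ℝ), τ ^ (-3 / 2 : ℝ) * E τ := by
    set c := v ^ 2 / (4 * y ^ 2) with hc
    have hcpos : 0 < c := by positivity
    have himg : (fun τ : ℝ => c / τ) '' Ioi 0 = Ioi 0 := by
      ext x
      constructor
      · rintro ⟨τ, hτ, rfl⟩
        exact div_pos hcpos hτ
      · intro hx
        have hx' : (0 : ℝ) < x := hx
        exact ⟨c / x, div_pos hcpos hx, by simp only; field_simp⟩
    have hinj2 : InjOn (fun τ : ℝ => c / τ) (Ioi 0) := by
      intro a ha b hb hab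
      have ha' : (0 : ℝ) < a := ha
      have hb' : (0 : ℝ) < b := hb
      simp only at hab
      field_simp at hab
      exact hab.symm
    have hd2 : ∀ τ ∈ Ioi (0 : ℝ),
        HasDerivWithinAt (fun τ : ℝ => c / τ) (-(c / τ ^ 2)) (Ioi 0) τ := by
      intro τ hτ
      have hτ' : τ ≠ 0 := (mem_Ioi.mp hτ).ne'
      have := ((hasDerivAt_inv hτ').const_mul c).hasDerivWithinAt (s := Ioi 0)
      simpa [div_eq_mul_inv] using this
    have key := integral_image_eq_integral_abs_deriv_smul measurableSet_Ioi hd2 hinj2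
      (fun τ => τ ^ (-1 / 2 : ℝ) * E τ)
    rw [himg] at key
    rw [key, ← integral_const_mul]
    refine setIntegral_congr_fun measurableSet_Ioi fun τ hτ => ?_
    have hτ' : (0 : ℝ) < τ := hτ
    have e1 : E (c / τ) = E τ := by
      simp only [hE]
      congr 1
      rw [hc]
      field_simp
      ring
    have e2 : (c / τ) ^ (-1 / 2 : ℝ) = 2 * y / v * τ ^ (1 / 2 : ℝ) := by
      rw [Real.div_rpow hcpos.le hτ'.le, show c = (v / (2 * y)) ^ (2 : ℕ) by rw [hc]; ring,
        ← Real.rpow_natCast, ← Real.rpow_mul (by positivity)]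
      norm_num
      rw [Real.rpow_neg_one, Real.rpow_neg hτ'.le]
      field_simp
    have e3 : τ ^ (-3 / 2 : ℝ) = τ ^ (1 / 2 : ℝ) / τ ^ 2 := by
      rw [← Real.rpow_natCast, ← Real.rpow_sub hτ']; norm_num
    simp only [smul_eq_mul, e1, e2, e3, abs_neg]
    rw [abs_of_pos (by positivity), hc]
    field_simp
    norm_num
  refine ⟨i2, ?_⟩
  rw [integral_const_mul, integral_add (i1.const_mul _) (i2.const_mul _), integral_const_mul,
    integral_const_mul, hrel] at hval
  rw [Real.exp_neg, ← hval]
  have := (Real.exp_pos (v * y)).ne'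
  change ∫ τ in Ioi (0 : ℝ), τ ^ (-3 / 2 : ℝ) * E τ = _
  generalize ∫ τ in Ioi (0 : ℝ), τ ^ (-3 / 2 : ℝ) * E τ = J
  field_simp
  ring

end Subordination

/-! ### The Bessel and Laplace kernels and Basset's formula. -/

noncomputable section

/-- `∫_0^∞ τ^{s-3/2} exp(-τ y² - M²/(4τ)) dτ`, a rescaled Bessel `K` function. -/
def besselKernel (s : ℂ) (y M : ℝ) : ℂ :=
  ∫ τ in Ioi (0 : ℝ), (τ : ℂ) ^ (s - 3 / 2) * (Real.exp (-(τ * y ^ 2) - M ^ 2 / (4 * τ)) : ℂ)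

/-- `∫_M^∞ e^{-yv} (v² - M²)^{s-1} dv`. -/
def laplaceKernel (s : ℂ) (y M : ℝ) : ℂ :=
  ∫ v in Ioi M, (Real.exp (-(y * v)) : ℂ) * ((v ^ 2 - M ^ 2 : ℝ) : ℂ) ^ (s - 1)

theorem norm_ofReal_cpow {x : ℝ} (hx : 0 < x) (s : ℂ) : ‖(x : ℂ) ^ s‖ = x ^ s.re :=
  Complex.norm_cpow_eq_rpow_re_of_pos hx s

theorem integrableOn_rpow_mul_exp_neg_mul {p r : ℝ} (hp : -1 < p) (hr : 0 < r) :
    IntegrableOn (fun τ : ℝ => τ ^ p * Real.exp (-(r * τ))) (Ioi 0) := by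
  simpa [neg_mul] using integrableOn_rpow_mul_exp_neg_mul_rpow hp one_pos hr

/-- From e^{-x} ≤ 1/x. The factor τ improves integrability at 0, and M⁻² is the decay that makes the
Fourier coefficients summable. -/
theorem exp_neg_div_le {M τ : ℝ} (hM : M ≠ 0) (hτ : 0 < τ) :
    Real.exp (-(M ^ 2 / (4 * τ))) ≤ 4 / M ^ 2 * τ := by
  have hx : 0 < M ^ 2 / (4 * τ) := by positivity
  calc Real.exp (-(M ^ 2 / (4 * τ))) = (Real.exp (M ^ 2 / (4 * τ)))⁻¹ := Real.exp_neg _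
    _ ≤ (M ^ 2 / (4 * τ))⁻¹ := by
        apply inv_anti₀ hx
        linarith [Real.add_one_le_exp (M ^ 2 / (4 * τ))]
    _ = 4 / M ^ 2 * τ := by field_simp

/-- Only τ → 0 matters: for M ≠ 0 the exponential supplies an extra τ, leaving τ^{σ-1/2}; for M = 0
the bare power τ^{σ-3/2} needs σ > 1/2. -/
theorem integrableOn_besselKernel_real {σ y M : ℝ} (hy : 0 < y) (hσ : 0 < σ)
    (h : M ≠ 0 ∨ 1 / 2 < σ) :
    IntegrableOn (fun τ : ℝ => τ ^ (σ - 3 / 2) * Real.exp (-(τ * y ^ 2) - M ^ 2 / (4 * τ)))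
      (Ioi 0) := by
  have hmeas : AEStronglyMeasurable
      (fun τ : ℝ => τ ^ (σ - 3 / 2) * Real.exp (-(τ * y ^ 2) - M ^ 2 / (4 * τ)))
      (volume.restrict (Ioi 0)) := Measurable.aestronglyMeasurable (by fun_prop)
  have hy2 : 0 < y ^ 2 := by positivity
  rcases h with h | h
  · refine ((integrableOn_rpow_mul_exp_neg_mul (p := σ - 1 / 2) (by linarith) hy2).const_mul
      (4 / M ^ 2)).mono' hmeas ?_
    refine (ae_restrict_iff' measurableSet_Ioi).mpr (Filter.Eventually.of_forall fun τ hτ => ?_)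
    have hτ' : (0 : ℝ) < τ := hτ
    rw [Real.norm_of_nonneg (by positivity), sub_eq_add_neg (-(τ * y ^ 2)), Real.exp_add,
      show σ - 1 / 2 = (σ - 3 / 2) + 1 by ring, Real.rpow_add_one hτ'.ne', mul_comm (y ^ 2)]
    have := exp_neg_div_le h hτ'
    calc _ = τ ^ (σ - 3 / 2) * Real.exp (-(τ * y ^ 2)) * Real.exp (-(M ^ 2 / (4 * τ))) := by ring
      _ ≤ τ ^ (σ - 3 / 2) * Real.exp (-(τ * y ^ 2)) * (4 / M ^ 2 * τ) := by gcongr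
      _ = _ := by ring
  · refine (integrableOn_rpow_mul_exp_neg_mul (p := σ - 3 / 2) (by linarith) hy2).mono' hmeas ?_
    refine (ae_restrict_iff' measurableSet_Ioi).mpr (Filter.Eventually.of_forall fun τ hτ => ?_)
    have hτ' : (0 : ℝ) < τ := hτ
    rw [Real.norm_of_nonneg (by positivity), mul_comm (y ^ 2)]
    gcongr
    have : 0 ≤ M ^ 2 / (4 * τ) := by positivity
    linarith

/-- The bound `O(M⁻²)` for the Bessel kernel. -/
theorem integral_besselKernel_real_le {σ y M : ℝ} (hy : 0 < y) (hσ : 0 < σ) (hM : M ≠ 0) :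
    ∫ τ in Ioi (0 : ℝ), τ ^ (σ - 3 / 2) * Real.exp (-(τ * y ^ 2) - M ^ 2 / (4 * τ)) ≤
      4 / M ^ 2 * ∫ τ in Ioi (0 : ℝ), τ ^ (σ - 1 / 2) * Real.exp (-(y ^ 2 * τ)) := by
  have hy2 : 0 < y ^ 2 := by positivity
  rw [← integral_const_mul]
  refine setIntegral_mono_on (integrableOn_besselKernel_real hy hσ (Or.inl hM))
    ((integrableOn_rpow_mul_exp_neg_mul (p := σ - 1 / 2) (by linarith) hy2).const_mul _)
    measurableSet_Ioi fun τ hτ => ?_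
  have hτ' : (0 : ℝ) < τ := hτ
  rw [sub_eq_add_neg (-(τ * y ^ 2)), Real.exp_add,
      show σ - 1 / 2 = (σ - 3 / 2) + 1 by ring, Real.rpow_add_one hτ'.ne', mul_comm (y ^ 2)]
  have := exp_neg_div_le hM hτ'
  calc _ = τ ^ (σ - 3 / 2) * Real.exp (-(τ * y ^ 2)) * Real.exp (-(M ^ 2 / (4 * τ))) := by ring
    _ ≤ τ ^ (σ - 3 / 2) * Real.exp (-(τ * y ^ 2)) * (4 / M ^ 2 * τ) := by gcongr
    _ = _ := by ring

theorem norm_besselKernel_le {s : ℂ} (y M : ℝ) :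
    ‖besselKernel s y M‖ ≤
      ∫ τ in Ioi (0 : ℝ), τ ^ (s.re - 3 / 2) * Real.exp (-(τ * y ^ 2) - M ^ 2 / (4 * τ)) := by
  refine (norm_integral_le_integral_norm _).trans_eq
    (setIntegral_congr_fun measurableSet_Ioi fun τ hτ => ?_)
  rw [norm_mul, norm_ofReal_cpow hτ, Complex.norm_real, Real.norm_of_nonneg (Real.exp_pos _).le]
  norm_num

theorem image_sq_sub {M : ℝ} (hM : 0 ≤ M) :
    (fun v : ℝ => v ^ 2 - M ^ 2) '' Ioi M = Ioi 0 := by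
  ext x
  constructor
  · rintro ⟨v, hv, rfl⟩
    have : M < v := hv
    simp only [mem_Ioi]
    nlinarith
  · intro hx
    have hx' : (0 : ℝ) < x := hx
    refine ⟨Real.sqrt (x + M ^ 2), ?_, ?_⟩
    · exact Real.lt_sqrt_of_sq_lt (by linarith)
    · simp only
      rw [Real.sq_sqrt (by positivity)]
      ring

theorem injOn_sq_sub {M : ℝ} (hM : 0 ≤ M) : InjOn (fun v : ℝ => v ^ 2 - M ^ 2) (Ioi M) := by
  intro a ha b hb hab
  have ha' : M < a := ha
  have hb' : M < b := hb
  simp only [sub_left_inj] at hab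
  exact (pow_left_inj₀ (hM.trans ha'.le) (hM.trans hb'.le) two_ne_zero).mp hab

theorem hasDerivWithinAt_sq_sub (M : ℝ) (s : Set ℝ) (v : ℝ) :
    HasDerivWithinAt (fun v : ℝ => v ^ 2 - M ^ 2) (2 * v) s v := by
  simpa using ((hasDerivAt_pow 2 v).sub_const (M ^ 2)).hasDerivWithinAt (s := s)

theorem integrableOn_cpow_mul_exp {a : ℂ} {r : ℝ} (ha : 0 < a.re) (hr : 0 < r) :
    IntegrableOn (fun t : ℝ => (t : ℂ) ^ (a - 1) * (Real.exp (-(r * t)) : ℂ)) (Ioi 0) := by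
  refine ((integrableOn_rpow_mul_exp_neg_mul (p := a.re - 1) (by linarith) hr)).mono'
    (Measurable.aestronglyMeasurable (by fun_prop)) ?_
  refine (ae_restrict_iff' measurableSet_Ioi).mpr (Filter.Eventually.of_forall fun τ hτ => ?_)
  rw [norm_mul, norm_ofReal_cpow hτ, Complex.norm_real, Real.norm_of_nonneg (Real.exp_pos _).le]
  simp

theorem integral_cpow_mul_exp {a : ℂ} {r : ℝ} (ha : 0 < a.re) (hr : 0 < r) :
    ∫ t in Ioi (0 : ℝ), (t : ℂ) ^ (a - 1) * (Real.exp (-(r * t)) : ℂ) =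
      (r : ℂ) ^ (-a) * Complex.Gamma a := by
  have h := Complex.integral_cpow_mul_exp_neg_mul_Ioi ha hr
  simp only [Complex.ofReal_exp, Complex.ofReal_neg, Complex.ofReal_mul]
  rw [h, one_div, Complex.inv_cpow, Complex.cpow_neg]
  rw [Complex.arg_ofReal_of_nonneg hr.le]
  exact Real.pi_pos.ne

/-- The integral over `v` in the proof of Basset's formula. -/
theorem integral_sq_sub_cpow_mul_exp {s : ℂ} (hs : 0 < s.re) {M τ : ℝ} (hM : 0 ≤ M)
    (hτ : 0 < τ) :
    IntegrableOn (fun v : ℝ => ((v ^ 2 - M ^ 2 : ℝ) : ℂ) ^ (s - 1) *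
        ((v * Real.exp (-(v ^ 2 / (4 * τ))) : ℝ) : ℂ)) (Ioi M) ∧
    ∫ v in Ioi M, ((v ^ 2 - M ^ 2 : ℝ) : ℂ) ^ (s - 1) *
        ((v * Real.exp (-(v ^ 2 / (4 * τ))) : ℝ) : ℂ) =
      1 / 2 * Complex.Gamma s * ((4 * τ : ℝ) : ℂ) ^ s * (Real.exp (-(M ^ 2 / (4 * τ))) : ℂ) := by
  have hr : 0 < 1 / (4 * τ) := by positivity
  -- The substitution w = v² - M² turns v dv into dw/2 and leaves a Gamma integral of rate 1/(4τ).
  set g : ℝ → ℂ := fun w => (1 / 2 * Real.exp (-(M ^ 2 / (4 * τ))) : ℝ) *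
    ((w : ℂ) ^ (s - 1) * (Real.exp (-(1 / (4 * τ) * w)) : ℂ)) with hg
  have hcongr : ∀ v ∈ Ioi M, |2 * v| • g (v ^ 2 - M ^ 2) =
      ((v ^ 2 - M ^ 2 : ℝ) : ℂ) ^ (s - 1) * ((v * Real.exp (-(v ^ 2 / (4 * τ))) : ℝ) : ℂ) := by
    intro v hv
    have hv0 : 0 ≤ v := hM.trans (le_of_lt hv)
    rw [abs_of_nonneg (by positivity), Complex.real_smul]
    simp only [hg]
    have : Real.exp (-(v ^ 2 / (4 * τ))) =
        Real.exp (-(M ^ 2 / (4 * τ))) * Real.exp (-(1 / (4 * τ) * (v ^ 2 - M ^ 2))) := by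
      rw [← Real.exp_add]; congr 1; ring
    rw [this]
    generalize ((v ^ 2 - M ^ 2 : ℝ) : ℂ) ^ (s - 1) = A
    push_cast
    ring
  have hd := fun v (_ : v ∈ Ioi M) => hasDerivWithinAt_sq_sub M (Ioi M) v
  have hgi : IntegrableOn g (Ioi 0) := (integrableOn_cpow_mul_exp hs hr).const_mul _
  constructor
  · rw [← integrableOn_congr_fun hcongr measurableSet_Ioi,
      ← integrableOn_image_iff_integrableOn_abs_deriv_smul measurableSet_Ioi hd (injOn_sq_sub hM) g,
      image_sq_sub hM]
    exact hgi
  · rw [← setIntegral_congr_fun measurableSet_Ioi hcongr,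
      ← integral_image_eq_integral_abs_deriv_smul measurableSet_Ioi hd (injOn_sq_sub hM) g,
      image_sq_sub hM]
    simp only [hg]
    rw [integral_const_mul, integral_cpow_mul_exp hs hr, one_div (4 * τ), Complex.ofReal_inv,
      Complex.inv_cpow, Complex.cpow_neg, inv_inv]
    · push_cast; ring
    · rw [Complex.arg_ofReal_of_nonneg (by positivity)]
      exact Real.pi_pos.ne

/-- Basset's formula: the Laplace kernel in terms of the Bessel kernel. -/
theorem laplaceKernel_eq {s : ℂ} {y M : ℝ} (hy : 0 < y) (hM : 0 ≤ M) (hs : 0 < s.re)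
    (h : M ≠ 0 ∨ 1 / 2 < s.re) :
    IntegrableOn (fun v : ℝ => (Real.exp (-(y * v)) : ℂ) * ((v ^ 2 - M ^ 2 : ℝ) : ℂ) ^ (s - 1))
      (Ioi M) ∧
    laplaceKernel s y M = Complex.Gamma s * (4 : ℂ) ^ (s - 1) * (Real.sqrt Real.pi : ℂ)⁻¹ *
      besselKernel s y M := by
  have hsp : 0 < Real.sqrt Real.pi := Real.sqrt_pos.mpr Real.pi_pos
  -- Here e^{-yv} is replaced by its subordination integral over τ. Integrating out τ restores the
  -- Laplace integrand, while integrating out v gives the Bessel integrand.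
  set F : ℝ → ℝ → ℂ := fun v τ => ((v ^ 2 - M ^ 2 : ℝ) : ℂ) ^ (s - 1) *
    ((v / (2 * Real.sqrt Real.pi) * (τ ^ (-3 / 2 : ℝ) *
      Real.exp (-(τ * y ^ 2) - v ^ 2 / (4 * τ))) : ℝ) : ℂ) with hF
  have hmeas : AEStronglyMeasurable (Function.uncurry F)
      ((volume.restrict (Ioi M)).prod (volume.restrict (Ioi 0))) := by
    refine Measurable.aestronglyMeasurable ?_
    simp only [hF, Function.uncurry_def]
    fun_prop
  have hFeq : ∀ v τ : ℝ, F v τ = ((1 / (2 * Real.sqrt Real.pi) * τ ^ (-3 / 2 : ℝ) *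
      Real.exp (-(τ * y ^ 2)) : ℝ) : ℂ) * (((v ^ 2 - M ^ 2 : ℝ) : ℂ) ^ (s - 1) *
        ((v * Real.exp (-(v ^ 2 / (4 * τ))) : ℝ) : ℂ)) := by
    intro v τ
    simp only [hF]
    rw [sub_eq_add_neg (-(τ * y ^ 2)), Real.exp_add]
    generalize ((v ^ 2 - M ^ 2 : ℝ) : ℂ) ^ (s - 1) = A
    push_cast
    ring
  have h1 : ∀ τ ∈ Ioi (0 : ℝ), IntegrableOn (fun v => F v τ) (Ioi M) := by
    intro τ hτ
    simp only [hFeq]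
    exact (integral_sq_sub_cpow_mul_exp hs hM hτ).1.const_mul _
  -- The exponent z is free because the identity is needed at s for the value and at Re s for the
  -- norm.
  have hvalpow : ∀ (z : ℂ) {τ : ℝ}, 0 < τ →
      ((1 / (2 * Real.sqrt Real.pi) * τ ^ (-3 / 2 : ℝ) * Real.exp (-(τ * y ^ 2)) : ℝ) : ℂ) *
      (1 / 2 * Complex.Gamma z * ((4 * τ : ℝ) : ℂ) ^ z * (Real.exp (-(M ^ 2 / (4 * τ))) : ℂ)) =
      Complex.Gamma z * (4 : ℂ) ^ (z - 1) * (Real.sqrt Real.pi : ℂ)⁻¹ *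
        ((τ : ℂ) ^ (z - 3 / 2) * (Real.exp (-(τ * y ^ 2) - M ^ 2 / (4 * τ)) : ℂ)) := by
    intro z τ hτ
    have hτ0 : (τ : ℂ) ≠ 0 := by exact_mod_cast hτ.ne'
    have e1 : ((4 * τ : ℝ) : ℂ) ^ z = 4 * 4 ^ (z - 1) * (τ : ℂ) ^ z := by
      rw [Complex.ofReal_mul, Complex.mul_cpow_ofReal_nonneg (by norm_num) hτ.le,
        Complex.cpow_sub _ _ (by norm_num)]
      norm_num
      left
      ring
    have e2 : ((τ ^ (-3 / 2 : ℝ) : ℝ) : ℂ) * (τ : ℂ) ^ z = (τ : ℂ) ^ (z - 3 / 2) := by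
      rw [Complex.ofReal_cpow hτ.le, ← Complex.cpow_add _ _ hτ0]
      congr 1
      push_cast
      ring
    rw [sub_eq_add_neg (-(τ * y ^ 2)), Real.exp_add, e1, ← e2]
    push_cast
    field_simp
    ring
  have hval : ∀ τ ∈ Ioi (0 : ℝ), ∫ v in Ioi M, F v τ =
      Complex.Gamma s * (4 : ℂ) ^ (s - 1) * (Real.sqrt Real.pi : ℂ)⁻¹ *
        ((τ : ℂ) ^ (s - 3 / 2) * (Real.exp (-(τ * y ^ 2) - M ^ 2 / (4 * τ)) : ℂ)) := by
    intro τ hτ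
    simp only [hFeq]
    rw [integral_const_mul, (integral_sq_sub_cpow_mul_exp hs hM hτ).2, hvalpow s hτ]
  have hnorm : ∀ τ ∈ Ioi (0 : ℝ), ∫ v in Ioi M, ‖F v τ‖ =
      Real.Gamma s.re * (4 : ℝ) ^ (s.re - 1) * (Real.sqrt Real.pi)⁻¹ *
        (τ ^ (s.re - 3 / 2) * Real.exp (-(τ * y ^ 2) - M ^ 2 / (4 * τ))) := by
    intro τ hτ
    have hτ' : (0 : ℝ) < τ := hτ
    have hre : 0 < ((s.re : ℂ)).re := by simpa using hs
    apply Complex.ofReal_injective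
    rw [← integral_complex_ofReal]
    have hc : ∀ v ∈ Ioi M, ((‖F v τ‖ : ℝ) : ℂ) =
        ((1 / (2 * Real.sqrt Real.pi) * τ ^ (-3 / 2 : ℝ) *
      Real.exp (-(τ * y ^ 2)) : ℝ) : ℂ) * (((v ^ 2 - M ^ 2 : ℝ) : ℂ) ^ ((s.re : ℂ) - 1) *
        ((v * Real.exp (-(v ^ 2 / (4 * τ))) : ℝ) : ℂ)) := by
      intro v hv
      have hv' : M < v := hv
      have hv0 : 0 ≤ v := hM.trans hv'.le
      have hd : 0 < v ^ 2 - M ^ 2 := by nlinarith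
      rw [hFeq, norm_mul, norm_mul, norm_ofReal_cpow hd, Complex.norm_real, Complex.norm_real,
        Real.norm_of_nonneg (by positivity), Real.norm_of_nonneg (by positivity)]
      rw [Complex.ofReal_mul, Complex.ofReal_mul _ (v * _), Complex.ofReal_cpow hd.le]
      simp
    rw [setIntegral_congr_fun measurableSet_Ioi hc, integral_const_mul,
      (integral_sq_sub_cpow_mul_exp hre hM hτ).2, hvalpow _ hτ]
    rw [Complex.Gamma_ofReal]
    push_cast
    rw [Complex.ofReal_cpow hτ'.le, Complex.ofReal_cpow (by norm_num)]
    push_cast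
    ring
  have h2 : Integrable (fun τ => ∫ v in Ioi M, ‖F v τ‖) (volume.restrict (Ioi 0)) := by
    have := (integrableOn_besselKernel_real (M := M) hy hs h).const_mul
      (Real.Gamma s.re * (4 : ℝ) ^ (s.re - 1) * (Real.sqrt Real.pi)⁻¹)
    exact (integrableOn_congr_fun hnorm measurableSet_Ioi).mpr this
  have key := integrable_integral_and_swap hmeas
    ((ae_restrict_iff' measurableSet_Ioi).mpr (Filter.Eventually.of_forall h1)) h2
  have hsec : ∀ v ∈ Ioi M, ∫ τ in Ioi (0 : ℝ), F v τ =
      (Real.exp (-(y * v)) : ℂ) * ((v ^ 2 - M ^ 2 : ℝ) : ℂ) ^ (s - 1) := by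
    intro v hv
    have hv0 : 0 < v := lt_of_le_of_lt hM hv
    simp only [hF]
    rw [integral_const_mul, integral_complex_ofReal, integral_const_mul,
      (integral_subordination hv0 hy).2]
    generalize ((v ^ 2 - M ^ 2 : ℝ) : ℂ) ^ (s - 1) = A
    have : v / (2 * Real.sqrt Real.pi) * (2 * Real.sqrt Real.pi / v * Real.exp (-(v * y))) =
        Real.exp (-(y * v)) := by
      rw [mul_comm v y]; field_simp
    rw [this, mul_comm]
  constructor
  · exact (integrableOn_congr_fun hsec measurableSet_Ioi).mp key.1
  · rw [laplaceKernel, ← setIntegral_congr_fun measurableSet_Ioi hsec, key.2,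
      setIntegral_congr_fun measurableSet_Ioi hval, integral_const_mul, besselKernel]

/-- The scaling τ = M t/(2y) balances the two terms of the exponent into (My/2)(t + 1/t). -/
theorem besselKernel_eq_besselK (s : ℂ) {y M : ℝ} (hy : 0 < y) (hM : 0 < M) :
    besselKernel s y M = 2 * ((M / (2 * y) : ℝ) : ℂ) ^ (s - 1 / 2) * besselK (s - 1 / 2) (M * y) := by
  have hc : 0 < M / (2 * y) := by positivity
  have hc0 : ((M / (2 * y) : ℝ) : ℂ) ≠ 0 := by exact_mod_cast hc.ne'
  have h := integral_comp_mul_left_Ioi' (fun τ : ℝ => (τ : ℂ) ^ (s - 3 / 2) *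
    (Real.exp (-(τ * y ^ 2) - M ^ 2 / (4 * τ)) : ℂ)) 0 hc
  rw [mul_zero] at h
  rw [besselKernel, ← h, besselK, Complex.real_smul, ← integral_const_mul, ← integral_const_mul,
    ← integral_const_mul]
  refine setIntegral_congr_fun measurableSet_Ioi fun t ht => ?_
  have ht' : (0 : ℝ) < t := ht
  have e1 : -(M / (2 * y) * t * y ^ 2) - M ^ 2 / (4 * (M / (2 * y) * t)) =
      -(M * y / 2) * (t + 1 / t) := by
    field_simp
    ring
  have e2 : ((M / (2 * y) * t : ℝ) : ℂ) ^ (s - 3 / 2) =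
      ((M / (2 * y) : ℝ) : ℂ) ^ (s - 1 / 2) * ((M / (2 * y) : ℝ) : ℂ)⁻¹ *
        (t : ℂ) ^ (s - 1 / 2 - 1) := by
    rw [Complex.ofReal_mul, Complex.mul_cpow_ofReal_nonneg hc.le ht'.le,
      show s - 3 / 2 = s - 1 / 2 - 1 by ring, Complex.cpow_sub _ _ hc0, Complex.cpow_one,
      div_eq_mul_inv]
  rw [e1, e2]
  field_simp

/-- The power degenerates to v^{2s-2}, leaving a Gamma integral; this serves m = 0. -/
theorem laplaceKernel_zero {s : ℂ} (hs : 1 / 2 < s.re) {y : ℝ} (hy : 0 < y) :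
    laplaceKernel s y 0 = (y : ℂ) ^ (1 - 2 * s) * Complex.Gamma (2 * s - 1) := by
  have ha : 0 < (2 * s - 1).re := by simp; linarith
  rw [← neg_sub (2 * s) 1, ← integral_cpow_mul_exp ha hy, laplaceKernel]
  refine setIntegral_congr_fun measurableSet_Ioi fun v hv => ?_
  have hv' : (0 : ℝ) < v := hv
  have hv0 : (v : ℂ) ≠ 0 := by exact_mod_cast hv'.ne'
  rw [mul_comm, show (2 * s - 1 - 1 : ℂ) = (2 : ℕ) * (s - 1) by push_cast; ring]
  congr 1
  rw [Complex.cpow_nat_mul, pow_two, zero_pow two_ne_zero, sub_zero, pow_two, Complex.ofReal_mul,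
    Complex.mul_cpow_ofReal_nonneg hv'.le hv'.le]

end

/-! ### Poisson summation for (t² + y²)^{-s}. -/

noncomputable section

/-- `(t² + y²)^{-s}`. -/
def poissonFun (s : ℂ) (y t : ℝ) : ℂ := ((t ^ 2 + y ^ 2 : ℝ) : ℂ) ^ (-s)

theorem continuous_e : Continuous e := by unfold e; fun_prop

theorem norm_e (x : ℝ) : ‖e x‖ = 1 := by
  rw [e, show (2 * Real.pi * Complex.I * x : ℂ) = ((2 * Real.pi * x : ℝ) : ℂ) * Complex.I by
    push_cast; ring, Complex.norm_exp_ofReal_mul_I]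

theorem e_add (x y : ℝ) : e (x + y) = e x * e y := by
  rw [e, e, e, ← Complex.exp_add]; push_cast; ring_nf

theorem integral_exp_neg_mul_sq_mul_e {τ : ℝ} (hτ : 0 < τ) (ξ : ℝ) :
    ∫ t : ℝ, (Real.exp (-(τ * t ^ 2)) : ℂ) * e (-(ξ * t)) =
      (Real.sqrt Real.pi * τ ^ (-1 / 2 : ℝ) * Real.exp (-((2 * Real.pi * |ξ|) ^ 2 / (4 * τ))) : ℝ) := by
  have h := fourierIntegral_gaussian (b := (τ : ℂ)) (by simpa using hτ) (-(2 * Real.pi * ξ : ℝ))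
  have e1 : ∀ t : ℝ, (Real.exp (-(τ * t ^ 2)) : ℂ) * e (-(ξ * t)) =
      Complex.exp (Complex.I * (-(2 * Real.pi * ξ : ℝ)) * t) * Complex.exp (-τ * t ^ 2) := by
    intro t
    rw [e, mul_comm]
    push_cast
    ring_nf
  simp_rw [e1]
  rw [h, ← Complex.ofReal_div, show (1 / 2 : ℂ) = ((1 / 2 : ℝ) : ℂ) by push_cast; ring,
    ← Complex.ofReal_cpow (by positivity), Real.div_rpow Real.pi_pos.le hτ.le, Real.sqrt_eq_rpow,
    show (-1 / 2 : ℝ) = -(1 / 2) by norm_num, Real.rpow_neg hτ.le, mul_pow (2 * Real.pi), sq_abs]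
  push_cast
  rw [div_eq_mul_inv]
  ring_nf

theorem integral_exp_neg_mul_sq {τ : ℝ} (hτ : 0 < τ) :
    ∫ t : ℝ, Real.exp (-(τ * t ^ 2)) = Real.sqrt Real.pi * τ ^ (-1 / 2 : ℝ) := by
  have h := integral_gaussian τ
  simp only [neg_mul] at h
  rw [h, Real.sqrt_div Real.pi_pos.le, show (-1 / 2 : ℝ) = -(1 / 2) by norm_num,
    Real.rpow_neg hτ.le, Real.sqrt_eq_rpow τ]
  rfl

/-- The Fourier transform of `(t² + y²)^{-s}`. -/
theorem integral_poissonFun_mul_e {s : ℂ} (hs : 1 / 2 < s.re) {y : ℝ} (hy : 0 < y) (ξ : ℝ) :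
    ∫ t : ℝ, poissonFun s y t * e (-(ξ * t)) =
      (Real.sqrt Real.pi : ℂ) * (Complex.Gamma s)⁻¹ * besselKernel s y (2 * Real.pi * |ξ|) := by
  have hs0 : 0 < s.re := by linarith
  have hΓ : Complex.Gamma s ≠ 0 := Complex.Gamma_ne_zero_of_re_pos hs0
  -- The Gamma integral writes Γ(s)(t² + y²)^{-s} as a superposition of Gaussians in t, each with an
  -- explicit Fourier transform.
  set F : ℝ → ℝ → ℂ := fun t τ => ((τ : ℂ) ^ (s - 1) * (Real.exp (-(τ * y ^ 2)) : ℂ)) *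
    ((Real.exp (-(τ * t ^ 2)) : ℂ) * e (-(ξ * t))) with hF
  have hmeas : AEStronglyMeasurable (Function.uncurry F)
      ((volume : Measure ℝ).prod (volume.restrict (Ioi 0))) := by
    refine Measurable.aestronglyMeasurable ?_
    have := continuous_e.measurable
    simp only [hF, Function.uncurry_def]
    fun_prop
  have hnorm : ∀ τ ∈ Ioi (0 : ℝ), ∀ t, ‖F t τ‖ =
      τ ^ (s.re - 1) * Real.exp (-(τ * y ^ 2)) * Real.exp (-(τ * t ^ 2)) := by
    intro τ hτ t
    simp only [hF]
    rw [norm_mul, norm_mul, norm_mul, norm_e, norm_ofReal_cpow hτ, Complex.norm_real,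
      Complex.norm_real, Real.norm_of_nonneg (Real.exp_pos _).le,
      Real.norm_of_nonneg (Real.exp_pos _).le]
    simp
  have hgauss : ∀ τ ∈ Ioi (0 : ℝ), Integrable (fun t : ℝ => Real.exp (-(τ * t ^ 2))) := by
    intro τ hτ
    simpa [neg_mul] using integrable_exp_neg_mul_sq (mem_Ioi.mp hτ)
  have h1 : ∀ τ ∈ Ioi (0 : ℝ), Integrable (fun t => F t τ) := by
    intro τ hτ
    refine ((hgauss τ hτ).const_mul (τ ^ (s.re - 1) * Real.exp (-(τ * y ^ 2)))).mono'
      ?_ (Filter.Eventually.of_forall fun t => (hnorm τ hτ t).le)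
    have := continuous_e
    refine Continuous.aestronglyMeasurable ?_
    simp only [hF]
    fun_prop
  have h2 : Integrable (fun τ => ∫ t, ‖F t τ‖) (volume.restrict (Ioi 0)) := by
    -- Taking norms removes the oscillation, which amounts to frequency 0; this is where Re s > 1/2
    -- enters.
    have hb := (integrableOn_besselKernel_real (M := 0) hy hs0 (Or.inr hs)).const_mul
      (Real.sqrt Real.pi)
    refine (integrableOn_congr_fun (fun τ hτ => ?_) measurableSet_Ioi).mpr hb
    have hτ' : (0 : ℝ) < τ := hτ
    simp only [hnorm τ hτ]
    rw [integral_const_mul, integral_exp_neg_mul_sq hτ',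
      show s.re - 3 / 2 = (s.re - 1) + (-1 / 2) by ring, Real.rpow_add hτ']
    simp
    ring
  have key := (integrable_integral_and_swap hmeas
    ((ae_restrict_iff' measurableSet_Ioi).mpr (Filter.Eventually.of_forall h1)) h2).2
  have hl : ∀ t : ℝ, ∫ τ in Ioi (0 : ℝ), F t τ =
      Complex.Gamma s * (poissonFun s y t * e (-(ξ * t))) := by
    intro t
    have hr : 0 < t ^ 2 + y ^ 2 := by positivity
    have := integral_cpow_mul_exp hs0 hr
    rw [poissonFun, ← mul_assoc, mul_comm (Complex.Gamma s), ← this, ← integral_mul_const]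
    refine setIntegral_congr_fun measurableSet_Ioi fun τ hτ => ?_
    simp only [hF]
    rw [show -((t ^ 2 + y ^ 2) * τ) = -(τ * y ^ 2) + -(τ * t ^ 2) by ring, Real.exp_add]
    push_cast
    ring
  have hr : ∀ τ ∈ Ioi (0 : ℝ), ∫ t : ℝ, F t τ =
      (Real.sqrt Real.pi : ℂ) * ((τ : ℂ) ^ (s - 3 / 2) *
        (Real.exp (-(τ * y ^ 2) - (2 * Real.pi * |ξ|) ^ 2 / (4 * τ)) : ℂ)) := by
    intro τ hτ
    have hτ' : (0 : ℝ) < τ := hτ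
    have hτ0 : (τ : ℂ) ≠ 0 := by exact_mod_cast hτ'.ne'
    simp only [hF]
    rw [integral_const_mul, integral_exp_neg_mul_sq_mul_e hτ' ξ, sub_eq_add_neg (-(τ * y ^ 2)),
      Real.exp_add, show s - 3 / 2 = (s - 1) + ((-1 / 2 : ℝ) : ℂ) by push_cast; ring,
      Complex.cpow_add _ _ hτ0, ← Complex.ofReal_cpow hτ'.le]
    push_cast
    ring
  simp only [hl] at key
  rw [integral_const_mul, setIntegral_congr_fun measurableSet_Ioi hr, integral_const_mul] at key
  rw [besselKernel, mul_right_comm, ← key]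
  field_simp

/-- The Fourier transform of `(t² + y²)^{-s}` at the integer `m`. -/
def poissonCoeff (s : ℂ) (y : ℝ) (m : ℤ) : ℂ :=
  (Real.sqrt Real.pi : ℂ) * (Complex.Gamma s)⁻¹ * besselKernel s y (2 * Real.pi * |(m : ℝ)|)

/-- This form isolates y in an exponential, so that a later integration over β acts as a Laplace
transform. -/
theorem poissonCoeff_eq_laplaceKernel {s : ℂ} (hs : 1 / 2 < s.re) {y : ℝ} (hy : 0 < y) (m : ℤ) :
    poissonCoeff s y m = Real.pi * (4 : ℂ) ^ (1 - s) * (Complex.Gamma s ^ 2)⁻¹ *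
      laplaceKernel s y (2 * Real.pi * |(m : ℝ)|) := by
  have hs0 : 0 < s.re := by linarith
  have hΓ : Complex.Gamma s ≠ 0 := Complex.Gamma_ne_zero_of_re_pos hs0
  have hsp : (Real.sqrt Real.pi : ℂ) ≠ 0 := by
    exact_mod_cast (Real.sqrt_pos.mpr Real.pi_pos).ne'
  have hsq : (Real.pi : ℂ) = Real.sqrt Real.pi * Real.sqrt Real.pi := by
    rw [← Complex.ofReal_mul, Real.mul_self_sqrt Real.pi_pos.le]
  have h4 : (4 : ℂ) ^ (s - 1) ≠ 0 := by simp [Complex.cpow_eq_zero_iff]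
  rw [poissonCoeff, (laplaceKernel_eq hy (by positivity) hs0 (Or.inr hs)).2, hsq,
    show (1 - s) = -(s - 1) by ring, Complex.cpow_neg]
  field_simp

theorem summable_poissonCoeff {s : ℂ} (hs : 1 / 2 < s.re) {y : ℝ} (hy : 0 < y) :
    Summable (poissonCoeff s y) := by
  have hs0 : 0 < s.re := by linarith
  set C : ℝ := ∫ τ in Ioi (0 : ℝ), τ ^ (s.re - 1 / 2) * Real.exp (-(y ^ 2 * τ)) with hC
  have hsum : Summable fun m : ℤ => C / Real.pi ^ 2 * (1 / (m : ℝ) ^ 2) :=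
    (Real.summable_one_div_int_pow.mpr one_lt_two).mul_left _
  have hbess : Summable fun m : ℤ => besselKernel s y (2 * Real.pi * |(m : ℝ)|) := by
    refine Summable.of_norm_bounded_eventually hsum ?_
    refine Filter.eventually_cofinite.mpr ((Set.finite_singleton (0 : ℤ)).subset fun m hm => ?_)
    by_contra hm0
    apply hm
    have hm1 : (m : ℝ) ≠ 0 := by exact_mod_cast hm0
    have hM : 2 * Real.pi * |(m : ℝ)| ≠ 0 := by
      have := Real.pi_pos
      positivity
    refine (norm_besselKernel_le y _).trans ((integral_besselKernel_real_le hy hs0 hM).trans_eq ?_)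
    rw [← hC, mul_pow, sq_abs]
    have := Real.pi_pos
    field_simp
    norm_num
  exact hbess.mul_left _

theorem norm_poissonFun {s : ℂ} {y : ℝ} (hy : 0 < y) (t : ℝ) :
    ‖poissonFun s y t‖ = (t ^ 2 + y ^ 2) ^ (-s.re) := by
  rw [poissonFun, norm_ofReal_cpow (by positivity), Complex.neg_re]

/-- Lagrange's identity ((x+t)² + y²)(x² + y²) = ((x+t)x + y²)² + y²t² gives the lower bound for
(x+t)² + y². -/
theorem norm_poissonFun_add_le {s : ℂ} (hs : 0 < s.re) {y : ℝ} (hy : 0 < y) (x : ℝ) {t : ℝ}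
    (ht : t ≠ 0) :
    ‖poissonFun s y (x + t)‖ ≤ (y ^ 2 / (x ^ 2 + y ^ 2)) ^ (-s.re) * |t| ^ (-(2 * s.re)) := by
  rw [norm_poissonFun hy, show -(2 * s.re) = 2 * -s.re by ring, Real.rpow_mul (abs_nonneg t),
    ← Real.mul_rpow (by positivity) (by positivity)]
  refine Real.rpow_le_rpow_of_nonpos (by positivity) ?_ (by linarith)
  rw [Real.rpow_two, sq_abs, div_mul_eq_mul_div, div_le_iff₀ (by positivity)]
  nlinarith [sq_nonneg ((x + t) * x + y ^ 2), sq_nonneg (x * (x + t) - y ^ 2)]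

theorem summable_poissonFun_add {s : ℂ} (hs : 1 / 2 < s.re) {y : ℝ} (hy : 0 < y) (x : ℝ) :
    Summable fun q : ℤ => poissonFun s y (x + q) := by
  refine Summable.of_norm_bounded_eventually
    ((Real.summable_abs_int_rpow (b := 2 * s.re) (by linarith)).mul_left
      ((y ^ 2 / (x ^ 2 + y ^ 2)) ^ (-s.re))) ?_
  refine Filter.eventually_cofinite.mpr ((Set.finite_singleton (0 : ℤ)).subset fun m hm => ?_)
  by_contra hm0
  exact hm (norm_poissonFun_add_le (by linarith) hy x (by exact_mod_cast hm0))

theorem continuous_poissonFun (s : ℂ) {y : ℝ} (hy : 0 < y) : Continuous (poissonFun s y) := by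
  unfold poissonFun
  refine Continuous.cpow (by fun_prop) continuous_const fun t => ?_
  exact Complex.ofReal_mem_slitPlane.mpr (by positivity)

/-- Poisson summation for `(t² + y²)^{-s}`. -/
theorem tsum_poissonFun_add {s : ℂ} (hs : 1 / 2 < s.re) {y : ℝ} (hy : 0 < y) (x : ℝ) :
    ∑' q : ℤ, poissonFun s y (x + q) = ∑' m : ℤ, poissonCoeff s y m * e (m * x) := by
  have hF : ∀ m : ℤ, FourierTransform.fourier (poissonFun s y) (m : ℝ) = poissonCoeff s y m := by
    intro m
    rw [poissonCoeff, ← integral_poissonFun_mul_e hs hy, Real.fourier_real_eq_integral_exp_smul]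
    congr 1
    ext t
    rw [smul_eq_mul, mul_comm, e]
    congr 2
    push_cast
    ring
  have hO : poissonFun s y =O[Filter.cocompact ℝ] fun t : ℝ => |t| ^ (-(2 * s.re)) := by
    refine Asymptotics.IsBigO.of_bound ((y ^ 2 / (0 ^ 2 + y ^ 2)) ^ (-s.re)) ?_
    have : ∀ᶠ t : ℝ in Filter.cocompact ℝ, t ≠ 0 := by
      have := (isCompact_singleton (x := (0 : ℝ))).compl_mem_cocompact
      filter_upwards [this] with t ht using ht
    filter_upwards [this] with t ht
    rw [Real.norm_of_nonneg (by positivity)]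
    have := norm_poissonFun_add_le (s := s) (by linarith) hy 0 ht
    rwa [zero_add] at this
  have hsum : Summable fun m : ℤ => FourierTransform.fourier (poissonFun s y) (m : ℝ) := by
    simp only [hF]
    exact summable_poissonCoeff hs hy
  rw [Real.tsum_eq_tsum_fourier_of_rpow_decay_of_summable (continuous_poissonFun s hy)
    (b := 2 * s.re) (by linarith) hO hsum x]
  refine tsum_congr fun m => ?_
  rw [hF, fourier_coe_apply, e]
  congr 2
  push_cast
  simp
  ring

end

/-! ### Binomial series, and the Laplace transforms of the weights built from G and H. -/

noncomputable section

section Binomial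

theorem poch_eq_ascPochhammer (α : ℝ) (k : ℕ) : poch α k = (ascPochhammer ℝ k).eval α := by
  induction k with
  | zero => simp [poch]
  | succ k ih => rw [ascPochhammer_succ_eval, ← ih, poch, poch, Finset.prod_range_succ]

theorem poch_div_factorial (α : ℝ) (k : ℕ) :
    poch α k / (k.factorial : ℝ) = Ring.choose (α + k - 1) k := by
  have h := Ring.factorial_nsmul_multichoose_eq_ascPochhammer α k
  rw [Polynomial.ascPochhammer_smeval_eq_eval, ← poch_eq_ascPochhammer, nsmul_eq_mul] at h
  rw [← Ring.multichoose_eq, ← h]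
  have : (k.factorial : ℝ) ≠ 0 := by positivity
  field_simp

/-- The binomial series of `(1 - x)^{-α}`. -/
theorem hasSum_poch (α : ℝ) {x : ℝ} (hx : |x| < 1) :
    HasSum (fun k : ℕ => poch α k / (k.factorial : ℝ) * x ^ k) ((1 - x) ^ (-α)) := by
  have h := (Real.one_div_one_sub_rpow_hasFPowerSeriesOnBall_zero α).hasSum (y := x) (by
    simpa [enorm_eq_nnnorm, ← NNReal.coe_lt_coe] using hx)
  have hx1 : 0 ≤ 1 - x := by linarith [(abs_lt.mp hx).2]
  simp only [FormalMultilinearSeries.ofScalars_apply_eq, zero_add, smul_eq_mul, one_div,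
    ← Real.rpow_neg hx1] at h
  simpa only [poch_div_factorial] using h

theorem poch_add (α : ℝ) (N j : ℕ) : poch α (j + N) = poch α N * poch (α + N) j := by
  rw [poch, poch, poch, add_comm j N, Finset.prod_range_add]
  congr 1
  refine Finset.prod_congr rfl fun i _ => ?_
  push_cast
  ring

theorem poch_nonneg {α : ℝ} (hα : 0 ≤ α) (j : ℕ) : 0 ≤ poch α j :=
  Finset.prod_nonneg fun i _ => by positivity

end Binomial

/-- Tonelli for the series of norms. It supplies the integrability of a weight that is known only as
a series. -/
theorem integrable_of_hasSum {α ι : Type*} [Countable ι] [MeasurableSpace α] {μ : Measure α}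
    {F : ι → α → ℝ} {f : α → ℝ} (hF : ∀ i, Integrable (F i) μ)
    (hsum : Summable fun i => ∫ a, ‖F i a‖ ∂μ) (hf : ∀ a, HasSum (fun i => F i a) (f a)) :
    Integrable f μ := by
  have hm : AEStronglyMeasurable f μ := by
    refine aestronglyMeasurable_of_tendsto_ae (u := Filter.atTop)
      (f := fun (s : Finset ι) a => ∑ i ∈ s, F i a) (fun s => ?_)
      (Filter.Eventually.of_forall fun a => hf a)
    exact Finset.aestronglyMeasurable_fun_sum s fun i _ => (hF i).1
  refine ⟨hm, ?_⟩
  have hfin : ∑' i, ∫⁻ a, ‖F i a‖ₑ ∂μ ≠ ⊤ := by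
    have h : ∀ i, ∫⁻ a, ‖F i a‖ₑ ∂μ = ENNReal.ofReal (∫ a, ‖F i a‖ ∂μ) := fun i =>
      (ofReal_integral_norm_eq_lintegral_enorm (hF i)).symm
    simp only [h]
    exact hsum.tsum_ofReal_ne_top
  rw [HasFiniteIntegral]
  calc ∫⁻ a, ‖f a‖ₑ ∂μ ≤ ∫⁻ a, ∑' i, ‖F i a‖ₑ ∂μ := by
        refine lintegral_mono fun a => ?_
        rw [← (hf a).tsum_eq]
        exact enorm_tsum_le_tsum_enorm
    _ = ∑' i, ∫⁻ a, ‖F i a‖ₑ ∂μ := lintegral_tsum fun i => (hF i).1.enorm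
    _ < ⊤ := lt_top_iff_ne_top.mpr hfin

section Weight

/-- The coefficient `2^k (α, k) / (k! (k - N)!)` at `k = j + N`. -/
def weightCoeff (α : ℝ) (N j : ℕ) : ℝ :=
  2 ^ (j + N) * poch α (j + N) / (((j + N).factorial : ℝ) * (j.factorial : ℝ))

/-- The weight `e^{-Mβ} M^N ∑_j 2^k (α, k) / (k! j!) (Mβ)^j`, `k = j + N`. -/
def weight (α : ℝ) (N : ℕ) (M β : ℝ) : ℝ :=
  Real.exp (-(M * β)) * (M ^ N * ∑' j : ℕ, weightCoeff α N j * (M * β) ^ j)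

theorem weightCoeff_eq (α : ℝ) (N j : ℕ) :
    weightCoeff α N j = 2 ^ (j + N) * (poch α (j + N) / ((j + N).factorial : ℝ)) /
      (j.factorial : ℝ) := by
  rw [weightCoeff]; field_simp

/-- Convergence of the binomial series at 1/2 bounds (α, k)/k! by C 2^k; the remaining 1/j! then
makes the series entire. -/
theorem summable_weightCoeff (α : ℝ) (N : ℕ) (z : ℝ) :
    Summable fun j : ℕ => weightCoeff α N j * z ^ j := by
  have h0 := (hasSum_poch α (x := 1 / 2) (by norm_num [abs_of_pos])).summable.norm
  obtain ⟨C, hC⟩ := h0.tendsto_atTop_zero.bddAbove_range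
  have hC' : ∀ k : ℕ, |poch α k / (k.factorial : ℝ)| ≤ C * 2 ^ k := by
    intro k
    have := hC ⟨k, rfl⟩
    simp only [norm_mul, norm_pow] at this
    rw [Real.norm_eq_abs, Real.norm_of_nonneg (by norm_num : (0 : ℝ) ≤ 1 / 2), one_div, inv_pow,
      ← div_eq_mul_inv, div_le_iff₀ (by positivity)] at this
    exact this
  refine Summable.of_norm_bounded
    (((Real.summable_pow_div_factorial (4 * |z|))).mul_left (C * 4 ^ N)) fun j => ?_
  rw [weightCoeff_eq, norm_mul, norm_div, norm_mul, norm_pow, norm_pow, Real.norm_eq_abs z,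
    Real.norm_of_nonneg (by positivity : (0 : ℝ) ≤ (j.factorial : ℝ)),
    Real.norm_of_nonneg (by norm_num : (0 : ℝ) ≤ 2), Real.norm_eq_abs]
  have := hC' (j + N)
  calc 2 ^ (j + N) * |poch α (j + N) / ((j + N).factorial : ℝ)| / (j.factorial : ℝ) * |z| ^ j
      ≤ 2 ^ (j + N) * (C * 2 ^ (j + N)) / (j.factorial : ℝ) * |z| ^ j := by gcongr
    _ = C * 4 ^ N * ((4 * |z|) ^ j / (j.factorial : ℝ)) := by
        rw [mul_pow, show (4 : ℝ) = 2 * 2 by norm_num, mul_pow, mul_pow, pow_add]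
        ring

theorem integral_pow_mul_exp_neg {q : ℝ} (hq : 0 < q) (j : ℕ) :
    IntegrableOn (fun β : ℝ => β ^ j * Real.exp (-(q * β))) (Ioi 0) ∧
    ∫ β in Ioi (0 : ℝ), β ^ j * Real.exp (-(q * β)) = (j.factorial : ℝ) / q ^ (j + 1) := by
  have hj : (-1 : ℝ) < j := by
    have : (0 : ℝ) ≤ j := by positivity
    linarith
  constructor
  · have := integrableOn_rpow_mul_exp_neg_mul hj hq
    simpa only [Real.rpow_natCast] using this
  · have := Real.integral_rpow_mul_exp_neg_mul_Ioi (a := j + 1) (by linarith) hq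
    simp only [add_sub_cancel_right, Real.rpow_natCast, Real.Gamma_nat_eq_factorial] at this
    rw [this, one_div, Real.inv_rpow hq.le, inv_mul_eq_div]
    congr 1
    exact_mod_cast Real.rpow_natCast q (j + 1)

/-- The Laplace transform of `weight`. -/
def weightLaplace (α : ℝ) (N : ℕ) (M v : ℝ) : ℝ :=
  (v + M) ^ N / (v + M) * ((1 - 2 * M / (v + M)) ^ (-α) -
    ∑ k ∈ Finset.range N, poch α k / (k.factorial : ℝ) * (2 * M / (v + M)) ^ k)

/-- In (α, j+N) = (α, N)(α+N, j) the second factor is nonnegative, so the weight keeps the sign of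
(α, N) on β ≥ 0. Hence its absolute Laplace integral is the absolute value of its transform. -/
theorem weight_sign {α : ℝ} {N : ℕ} (hα : 0 < α + N) {M β : ℝ} (hM : 0 ≤ M) (hβ : 0 ≤ β) :
    0 ≤ poch α N * weight α N M β := by
  have h : ∀ j, 0 ≤ poch α N * (weightCoeff α N j * (M * β) ^ j) := by
    intro j
    have h1 := poch_nonneg hα.le j
    rw [weightCoeff, poch_add]
    have : poch α N * (2 ^ (j + N) * (poch α N * poch (α + N) j) /
        (((j + N).factorial : ℝ) * (j.factorial : ℝ)) * (M * β) ^ j) =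
        poch α N ^ 2 * (2 ^ (j + N) * poch (α + N) j /
        (((j + N).factorial : ℝ) * (j.factorial : ℝ)) * (M * β) ^ j) := by ring
    rw [this]
    positivity
  have h2 : 0 ≤ ∑' j : ℕ, poch α N * (weightCoeff α N j * (M * β) ^ j) := tsum_nonneg h
  rw [tsum_mul_left] at h2
  have : poch α N * weight α N M β = Real.exp (-(M * β)) * M ^ N *
      (poch α N * ∑' j : ℕ, weightCoeff α N j * (M * β) ^ j) := by rw [weight]; ring
  rw [this]
  positivity

theorem integral_abs_of_sign {f : ℝ → ℝ} {s : Set ℝ} (hs : MeasurableSet s)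
    (h : (∀ x ∈ s, 0 ≤ f x) ∨ ∀ x ∈ s, f x ≤ 0) :
    ∫ x in s, |f x| = |∫ x in s, f x| := by
  rcases h with h | h
  · rw [abs_of_nonneg (setIntegral_nonneg hs h)]
    exact setIntegral_congr_fun hs fun x hx => abs_of_nonneg (h x hx)
  · rw [abs_of_nonpos (setIntegral_nonpos hs h), ← integral_neg]
    exact setIntegral_congr_fun hs fun x hx => abs_of_nonpos (h x hx)

/-- Each β^j e^{-(v+M)β} integrates to j!/(v+M)^{j+1}, which cancels the j! of the coefficient and
leaves the binomial series of (1 - x)^{-α} at x = 2M/(v+M), from index N on. The condition M < v is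
|x| < 1. -/
theorem laplace_weight {α : ℝ} {N : ℕ} (hα : 0 < α + N) {M v : ℝ} (hM : 0 ≤ M) (hv : M < v) :
    IntegrableOn (fun β => Real.exp (-(v * β)) * weight α N M β) (Ioi 0) ∧
    ∫ β in Ioi (0 : ℝ), Real.exp (-(v * β)) * weight α N M β = weightLaplace α N M v ∧
    ∫ β in Ioi (0 : ℝ), |Real.exp (-(v * β)) * weight α N M β| = |weightLaplace α N M v| := by
  have hq : 0 < v + M := by linarith
  have hx : |2 * M / (v + M)| < 1 := by
    rw [abs_of_nonneg (by positivity), div_lt_one hq]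
    linarith
  set q := v + M with hqdef
  set F : ℕ → ℝ → ℝ := fun j β => (M ^ N * weightCoeff α N j * M ^ j) *
    (β ^ j * Real.exp (-(q * β))) with hF
  have hFi : ∀ j, IntegrableOn (F j) (Ioi 0) := fun j =>
    (integral_pow_mul_exp_neg hq j).1.const_mul _
  have hFv : ∀ j, ∫ β in Ioi (0 : ℝ), F j β =
      q ^ N / q * (poch α (j + N) / ((j + N).factorial : ℝ) * (2 * M / q) ^ (j + N)) := by
    intro j
    simp only [hF]
    rw [integral_const_mul, (integral_pow_mul_exp_neg hq j).2, weightCoeff_eq]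
    have : (j.factorial : ℝ) ≠ 0 := by positivity
    rw [div_pow, mul_pow]
    field_simp
    ring
  have hFn : ∀ j, ∫ β in Ioi (0 : ℝ), ‖F j β‖ = |∫ β in Ioi (0 : ℝ), F j β| := by
    intro j
    refine integral_abs_of_sign measurableSet_Ioi ?_
    rcases le_total 0 (M ^ N * weightCoeff α N j * M ^ j) with h | h
    · left
      intro β hβ
      have : (0 : ℝ) < β := hβ
      simp only [hF]
      positivity
    · right
      intro β hβ
      have : (0 : ℝ) < β := hβ
      simp only [hF]
      exact mul_nonpos_of_nonpos_of_nonneg h (by positivity)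
  have hbin := hasSum_poch α hx
  have hS : HasSum (fun j => ∫ β in Ioi (0 : ℝ), F j β) (weightLaplace α N M v) := by
    simp only [hFv]
    exact ((hasSum_nat_add_iff' N).mpr hbin).mul_left _
  have hpt : ∀ β, HasSum (fun j => F j β) (Real.exp (-(v * β)) * weight α N M β) := by
    intro β
    have h := ((summable_weightCoeff α N (M * β)).hasSum.mul_left
      (Real.exp (-(q * β)) * M ^ N))
    convert! h using 1
    · ext j
      simp only [hF]
      rw [mul_pow]
      ring
    · rw [weight, hqdef, add_mul, neg_add, Real.exp_add]
      ring
  have hint := integrable_of_hasSum (μ := volume.restrict (Ioi 0)) hFi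
    (by simpa only [hFn] using hS.summable.abs) hpt
  have hval : ∫ β in Ioi (0 : ℝ), Real.exp (-(v * β)) * weight α N M β =
      weightLaplace α N M v := by
    have h := hasSum_integral_of_summable_integral_norm (μ := volume.restrict (Ioi 0)) hFi
      (by simpa only [hFn] using hS.summable.abs)
    simp only [(hpt _).tsum_eq] at h
    exact h.unique hS
  refine ⟨hint, hval, ?_⟩
  rw [← hval]
  refine integral_abs_of_sign measurableSet_Ioi ?_
  -- If (α, N) = 0 the weight vanishes identically. This does occur: α = 1 - n/2, N = n - 1 with n ≥
  -- 2 even.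
  rcases lt_trichotomy (poch α N) 0 with h | h | h
  · right
    intro β hβ
    have h1 := weight_sign hα hM (le_of_lt hβ)
    exact mul_nonpos_of_nonneg_of_nonpos (Real.exp_pos _).le
      (nonpos_of_mul_nonneg_right h1 h)
  · left
    intro β hβ
    have : ∀ j, weightCoeff α N j = 0 := fun j => by rw [weightCoeff, poch_add, h]; simp
    simp [weight, this]
  · left
    intro β hβ
    exact mul_nonneg (Real.exp_pos _).le
      (nonneg_of_mul_nonneg_right (weight_sign hα hM (le_of_lt hβ)) h)

/-- Closed form of the Laplace transform for `α = 1 - n/2`, `N = n - 1`. -/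
theorem weightLaplace_eq {n : ℕ} (hn : 1 ≤ n) {M v : ℝ} (hM : 0 ≤ M) (hv : M < v) :
    weightLaplace (1 - n / 2) (n - 1) M v = (v ^ 2 - M ^ 2) ^ ((n : ℝ) / 2 - 1) -
      ∑ k ∈ Finset.range (n - 1), poch (1 - n / 2) k / (k.factorial : ℝ) * (2 * M) ^ k *
        (v + M) ^ ((n : ℝ) - 2 - k) := by
  have hq : 0 < v + M := by linarith
  have hd : 0 < v - M := by linarith
  have hN : (((n - 1 : ℕ) : ℝ)) = n - 1 := by push_cast [hn]; ring
  have hqN : (v + M) ^ (n - 1) / (v + M) = (v + M) ^ ((n : ℝ) - 2) := by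
    rw [← Real.rpow_natCast, hN, ← Real.rpow_sub_one hq.ne']
    congr 1
    ring
  rw [weightLaplace, hqN, mul_sub, Finset.mul_sum]
  congr 1
  · have e1 : 1 - 2 * M / (v + M) = (v - M) / (v + M) := by field_simp; ring
    rw [e1, show v ^ 2 - M ^ 2 = (v - M) * (v + M) by ring, Real.div_rpow hd.le hq.le,
      Real.mul_rpow hd.le hq.le, neg_sub, mul_comm, div_mul_eq_mul_div, mul_div_assoc,
      ← Real.rpow_sub hq]
    congr 2
    ring
  · refine Finset.sum_congr rfl fun k _ => ?_
    rw [Real.rpow_sub hq _ (k : ℝ), Real.rpow_natCast, div_pow]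
    ring

theorem weightLaplace_one {M v : ℝ} (hM : 0 ≤ M) (hv : M < v) :
    weightLaplace (1 / 2) 0 M v = (v ^ 2 - M ^ 2) ^ (-1 / 2 : ℝ) := by
  have h := weightLaplace_eq (n := 1) le_rfl hM hv
  norm_num at h
  norm_num
  exact h

/-- The factor β^{n-1} split off here is the one that cancels β^{1-n} in the coefficient of the
Eisenstein series. -/
theorem exp_mul_seriesH (n : ℕ) (M β : ℝ) :
    Real.exp (-(M * β)) * seriesH n (M * β) = β ^ (n - 1) * weight (1 - n / 2) (n - 1) M β := by
  have : seriesH n (M * β) = (M * β) ^ (n - 1) *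
      ∑' j : ℕ, weightCoeff (1 - n / 2) (n - 1) j * (M * β) ^ j := by
    rw [seriesH, ← tsum_mul_left]
    refine tsum_congr fun j => ?_
    rw [weightCoeff, pow_add (M * β)]
    ring
  rw [this, weight, mul_pow]
  ring

theorem centralBinom_eq_poch (k : ℕ) :
    ((2 * k).choose k : ℝ) = 4 ^ k * poch (1 / 2) k / (k.factorial : ℝ) := by
  induction k with
  | zero => simp [poch]
  | succ k ih =>
    have h := Nat.succ_mul_centralBinom_succ k
    have h' : ((k : ℝ) + 1) * ((2 * (k + 1)).choose (k + 1) : ℝ) =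
        2 * (2 * k + 1) * ((2 * k).choose k : ℝ) := by exact_mod_cast h
    have hp : poch (1 / 2) (k + 1) = poch (1 / 2) k * (1 / 2 + k) := by
      rw [poch, poch, Finset.prod_range_succ]
    have hk : (k : ℝ) + 1 ≠ 0 := by positivity
    rw [ih] at h'
    rw [hp, Nat.factorial_succ]
    push_cast
    have hf : (k.factorial : ℝ) ≠ 0 := by positivity
    field_simp at h' ⊢
    rw [pow_succ]
    linear_combination 2 * h'

theorem exp_mul_seriesG (M β : ℝ) :
    Real.exp (-(M * β)) * seriesG (M * β) = weight (1 / 2) 0 M β := by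
  rw [weight, seriesG, pow_zero, one_mul]
  congr 1
  refine tsum_congr fun k => ?_
  rw [weightCoeff, centralBinom_eq_poch, add_zero, show (4 : ℝ) = 2 * 2 by norm_num, mul_pow]
  have hf : (k.factorial : ℝ) ≠ 0 := by positivity
  field_simp

end Weight

end

/-! ### Integration of the Laplace kernel against the weights. -/

noncomputable section

/-- Integration of the Laplace kernel against a weight `g` with known Laplace transform `P`. -/
theorem integral_laplaceKernel_mul {X : Type*} [MeasurableSpace X] {μ : Measure X} [SFinite μ]
    {S g : X → ℝ} (hS : Measurable S) {P : ℝ → ℝ} {s : ℂ} {ρ M : ℝ}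
    (hg : ∀ v ∈ Ioi M, Integrable (fun x => Real.exp (-(v * S x)) * g x) μ)
    (hP : ∀ v ∈ Ioi M, ∫ x, Real.exp (-(v * S x)) * g x ∂μ = P v)
    (hPabs : ∀ v ∈ Ioi M, ∫ x, |Real.exp (-(v * S x)) * g x| ∂μ = |P v|)
    (hint : IntegrableOn (fun v : ℝ => (Real.exp (-(ρ * v)) : ℂ) *
      ((v ^ 2 - M ^ 2 : ℝ) : ℂ) ^ (s - 1) * (P v : ℂ)) (Ioi M)) :
    Integrable (fun x => laplaceKernel s (ρ + S x) M * (g x : ℂ)) μ ∧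
    ∫ x, laplaceKernel s (ρ + S x) M * (g x : ℂ) ∂μ =
      ∫ v in Ioi M, (Real.exp (-(ρ * v)) : ℂ) * ((v ^ 2 - M ^ 2 : ℝ) : ℂ) ^ (s - 1) * (P v : ℂ) := by
  set A : ℝ → ℂ := fun v => (Real.exp (-(ρ * v)) : ℂ) * ((v ^ 2 - M ^ 2 : ℝ) : ℂ) ^ (s - 1) with hA
  set F : X → ℝ → ℂ := fun x v => A v * ((Real.exp (-(v * S x)) * g x : ℝ) : ℂ) with hF
  -- Measurability of g is read off from the single section v = M + 1 by undoing its exponential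
  -- factor.
  have hgm : AEStronglyMeasurable g μ := by
    have h1 := (hg (M + 1) (by simp)).1
    have h2 : AEStronglyMeasurable (fun x => Real.exp ((M + 1) * S x)) μ :=
      Measurable.aestronglyMeasurable (by fun_prop)
    refine (h2.mul h1).congr (Filter.Eventually.of_forall fun x => ?_)
    simp only [Pi.mul_apply]
    rw [← mul_assoc, ← Real.exp_add]
    simp
  have hmeas : AEStronglyMeasurable (Function.uncurry F) (μ.prod (volume.restrict (Ioi M))) := by
    have h1 : AEStronglyMeasurable (fun p : X × ℝ => A p.2 * (Real.exp (-(p.2 * S p.1)) : ℂ))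
        (μ.prod (volume.restrict (Ioi M))) := by
      refine Measurable.aestronglyMeasurable ?_
      simp only [hA]
      fun_prop
    have h2 : AEStronglyMeasurable (fun p : X × ℝ => (g p.1 : ℂ))
        (μ.prod (volume.restrict (Ioi M))) :=
      Complex.continuous_ofReal.comp_aestronglyMeasurable hgm.comp_fst
    refine (h1.mul h2).congr (Filter.Eventually.of_forall fun p => ?_)
    simp only [Pi.mul_apply, hF, Function.uncurry_def]
    push_cast
    ring
  have h1 : ∀ v ∈ Ioi M, Integrable (fun x => F x v) μ := fun v hv =>
    (hg v hv).ofReal.const_mul _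
  -- Since the L¹ norm of each section is |P v|, the absolute convergence required by Fubini is that
  -- of the resulting v-integral.
  have h2 : Integrable (fun v => ∫ x, ‖F x v‖ ∂μ) (volume.restrict (Ioi M)) := by
    refine (integrableOn_congr_fun (fun v hv => ?_) measurableSet_Ioi).mpr hint.norm
    simp only [hF, norm_mul, Complex.norm_real]
    rw [integral_const_mul]
    congr 1
    · simp only [hA, norm_mul, Complex.norm_real]
    · simpa only [Real.norm_eq_abs, abs_mul] using hPabs v hv
  have key := integrable_integral_and_swap hmeas
    ((ae_restrict_iff' measurableSet_Ioi).mpr (Filter.Eventually.of_forall h1)) h2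
  have hl : ∀ x, ∫ v in Ioi M, F x v = laplaceKernel s (ρ + S x) M * (g x : ℂ) := by
    intro x
    rw [laplaceKernel, ← integral_mul_const]
    refine setIntegral_congr_fun measurableSet_Ioi fun v _ => ?_
    simp only [hF, hA]
    rw [add_mul, neg_add, Real.exp_add, mul_comm (S x)]
    push_cast
    ring
  simp only [hl] at key
  refine ⟨key.1, key.2.trans (setIntegral_congr_fun measurableSet_Ioi fun v hv => ?_)⟩
  simp only [hF]
  rw [integral_const_mul, integral_complex_ofReal, hP v hv]

/-- Integration over `(0, ∞)ⁿ` against `∏ weight` shifts the parameter by `n/2`. -/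
theorem integral_laplaceKernel_mul_prod_weight {n : ℕ} {s : ℂ} {ρ M : ℝ} (hρ : 0 < ρ)
    (hM : 0 ≤ M) (hs : (n : ℝ) / 2 < s.re) (h : M ≠ 0 ∨ ((n : ℝ) + 1) / 2 < s.re) :
    IntegrableOn (fun b : Fin n → ℝ => laplaceKernel s (ρ + ∑ j, b j) M *
      ((∏ j, weight (1 / 2) 0 M (b j) : ℝ) : ℂ)) (Set.univ.pi fun _ => Ioi 0) ∧
    ∫ b in Set.univ.pi (fun _ : Fin n => Ioi (0 : ℝ)), laplaceKernel s (ρ + ∑ j, b j) M *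
      ((∏ j, weight (1 / 2) 0 M (b j) : ℝ) : ℂ) = laplaceKernel (s - n / 2) ρ M := by
  have hα : (0 : ℝ) < 1 / 2 + (0 : ℕ) := by norm_num
  have hprod : ∀ (v : ℝ) (b : Fin n → ℝ), Real.exp (-(v * ∑ j, b j)) *
      ∏ j, weight (1 / 2) 0 M (b j) = ∏ j, (Real.exp (-(v * b j)) * weight (1 / 2) 0 M (b j)) := by
    intro v b
    rw [Finset.prod_mul_distrib, ← Real.exp_sum, Finset.mul_sum, Finset.sum_neg_distrib]
  have hre : 0 < (s - n / 2).re := by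
    rw [show (n : ℂ) / 2 = (((n : ℝ) / 2 : ℝ) : ℂ) by push_cast; rfl, Complex.sub_re,
      Complex.ofReal_re]
    linarith
  have hre2 : M ≠ 0 ∨ 1 / 2 < (s - n / 2).re := by
    refine h.imp id fun h => ?_
    rw [show (n : ℂ) / 2 = (((n : ℝ) / 2 : ℝ) : ℂ) by push_cast; rfl, Complex.sub_re,
      Complex.ofReal_re]
    linarith
  -- Each of the n coordinates contributes (v² - M²)^{-1/2}, which shifts s to s - n/2.
  have hpow : ∀ v ∈ Ioi M, (Real.exp (-(ρ * v)) : ℂ) *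
      ((v ^ 2 - M ^ 2 : ℝ) : ℂ) ^ (s - 1) * (((v ^ 2 - M ^ 2) ^ (-1 / 2 : ℝ)) ^ n : ℝ) =
      (Real.exp (-(ρ * v)) : ℂ) * ((v ^ 2 - M ^ 2 : ℝ) : ℂ) ^ (s - n / 2 - 1) := by
    intro v hv
    have hv' : M < v := hv
    have hd : 0 < v ^ 2 - M ^ 2 := by nlinarith
    have hd0 : ((v ^ 2 - M ^ 2 : ℝ) : ℂ) ≠ 0 := by exact_mod_cast hd.ne'
    rw [mul_assoc, ← Real.rpow_mul_natCast hd.le, Complex.ofReal_cpow hd.le,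
      ← Complex.cpow_add _ _ hd0]
    congr 2
    push_cast
    ring
  have hbase := (laplaceKernel_eq hρ hM hre hre2).1
  have key := integral_laplaceKernel_mul (μ := (volume : Measure (Fin n → ℝ)).restrict
      (Set.univ.pi fun _ => Ioi 0)) (S := fun b => ∑ j, b j)
      (g := fun b => ∏ j, weight (1 / 2) 0 M (b j)) (by fun_prop)
      (P := fun v => ((v ^ 2 - M ^ 2) ^ (-1 / 2 : ℝ)) ^ n) (s := s) (ρ := ρ) (M := M) ?_ ?_ ?_ ?_
  · refine ⟨key.1, key.2.trans ?_⟩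
    rw [laplaceKernel]
    exact setIntegral_congr_fun measurableSet_Ioi hpow
  · intro v hv
    simp only [hprod]
    rw [volume_pi, Measure.restrict_pi_pi]
    exact Integrable.fintype_prod fun _ => (laplace_weight hα hM hv).1
  · intro v hv
    simp only [hprod]
    rw [volume_pi, Measure.restrict_pi_pi]
    rw [integral_fintype_prod_eq_pow (fun b => Real.exp (-(v * b)) * weight (1 / 2) 0 M b),
      (laplace_weight hα hM hv).2.1, weightLaplace_one hM hv, Fintype.card_fin]
  · intro v hv
    have hv' : M < v := hv
    have hd : 0 < v ^ 2 - M ^ 2 := by nlinarith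
    simp only [hprod, Finset.abs_prod]
    rw [volume_pi, Measure.restrict_pi_pi]
    rw [integral_fintype_prod_eq_pow (fun b => |Real.exp (-(v * b)) * weight (1 / 2) 0 M b|),
      (laplace_weight hα hM hv).2.2, weightLaplace_one hM hv, Fintype.card_fin, abs_pow]
  · exact (integrableOn_congr_fun hpow measurableSet_Ioi).mpr hbase

/-- Tricomi's integral in the variable `v = M + 2Mt`. -/
theorem integral_sq_sub_cpow_mul_add_pow {a : ℂ} (ha : 0 < a.re) (p : ℕ) {ρ M : ℝ} (hρ : 0 < ρ)
    (hM : 0 < M) :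
    IntegrableOn (fun v : ℝ => (Real.exp (-(ρ * v)) : ℂ) * ((v ^ 2 - M ^ 2 : ℝ) : ℂ) ^ (a - 1) *
      ((v + M) ^ p : ℝ)) (Ioi M) ∧
    ∫ v in Ioi M, (Real.exp (-(ρ * v)) : ℂ) * ((v ^ 2 - M ^ 2 : ℝ) : ℂ) ^ (a - 1) *
      ((v + M) ^ p : ℝ) = (Real.exp (-(M * ρ)) : ℂ) * ((2 * M : ℝ) : ℂ) ^ (2 * a - 1 + p) *
        Complex.Gamma a * tricomiPsi a (2 * a + p) (2 * M * ρ) := by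
  constructor
  · have h0 := (laplaceKernel_eq (half_pos hρ) hM.le ha (Or.inl hM.ne')).1
    refine (h0.norm.const_mul (p.factorial * (2 / ρ) ^ p * Real.exp (ρ / 2 * M))).mono'
      (Measurable.aestronglyMeasurable (by fun_prop)) ?_
    refine (ae_restrict_iff' measurableSet_Ioi).mpr (Filter.Eventually.of_forall fun v hv => ?_)
    have hv' : M < v := hv
    have hvM : 0 ≤ v + M := by linarith
    rw [norm_mul, norm_mul, norm_mul, Complex.norm_real, Complex.norm_real, Complex.norm_real,
      Real.norm_of_nonneg (Real.exp_pos _).le, Real.norm_of_nonneg (Real.exp_pos _).le,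
      Real.norm_of_nonneg (by positivity)]
    have h1 := Real.pow_div_factorial_le_exp (ρ / 2 * (v + M)) (by positivity) p
    rw [div_le_iff₀ (by positivity), mul_pow] at h1
    have h2 : (v + M) ^ p ≤ p.factorial * (2 / ρ) ^ p * Real.exp (ρ / 2 * (v + M)) := by
      have : (v + M) ^ p = (2 / ρ) ^ p * ((ρ / 2) ^ p * (v + M) ^ p) := by
        rw [← mul_assoc, ← mul_pow]
        field_simp
        simp
      rw [this]
      calc _ ≤ (2 / ρ) ^ p * (Real.exp (ρ / 2 * (v + M)) * p.factorial) := by gcongr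
        _ = _ := by ring
    have hX := norm_nonneg (((v ^ 2 - M ^ 2 : ℝ) : ℂ) ^ (a - 1))
    generalize ‖((v ^ 2 - M ^ 2 : ℝ) : ℂ) ^ (a - 1)‖ = X at *
    have e1 : Real.exp (-(ρ * v)) * Real.exp (ρ / 2 * (v + M)) =
        Real.exp (ρ / 2 * M) * Real.exp (-(ρ / 2 * v)) := by
      rw [← Real.exp_add, ← Real.exp_add]; congr 1; ring
    calc Real.exp (-(ρ * v)) * X * (v + M) ^ p
        ≤ Real.exp (-(ρ * v)) * X * (p.factorial * (2 / ρ) ^ p * Real.exp (ρ / 2 * (v + M))) := by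
          gcongr
      _ = p.factorial * (2 / ρ) ^ p * X * (Real.exp (-(ρ * v)) * Real.exp (ρ / 2 * (v + M))) := by
          ring
      _ = _ := by rw [e1]; ring
  · set g : ℝ → ℂ := fun v => (Real.exp (-(ρ * v)) : ℂ) * ((v ^ 2 - M ^ 2 : ℝ) : ℂ) ^ (a - 1) *
      ((v + M) ^ p : ℝ) with hg
    have himg : (fun t : ℝ => M + 2 * M * t) '' Ioi 0 = Ioi M := by
      ext v
      constructor
      · rintro ⟨t, ht, rfl⟩
        have : (0 : ℝ) < t := ht
        simp only [mem_Ioi]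
        have : 0 < 2 * M * t := by positivity
        linarith
      · intro hv
        have hv' : M < v := hv
        refine ⟨(v - M) / (2 * M), ?_, ?_⟩
        · simp only [mem_Ioi]
          have : 0 < v - M := by linarith
          positivity
        · simp only
          field_simp
          ring
    have hinj : InjOn (fun t : ℝ => M + 2 * M * t) (Ioi 0) := by
      intro x _ y _ hxy
      simp only at hxy
      have : 2 * M * (x - y) = 0 := by linarith
      rcases mul_eq_zero.mp this with h | h <;> linarith
    have hd : ∀ t ∈ Ioi (0 : ℝ),
        HasDerivWithinAt (fun t : ℝ => M + 2 * M * t) (2 * M) (Ioi 0) t := by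
      intro t _
      simpa using (((hasDerivAt_id t).const_mul (2 * M)).const_add M).hasDerivWithinAt (s := Ioi 0)
    have h := integral_image_eq_integral_abs_deriv_smul measurableSet_Ioi hd hinj g
    have hΓ : Complex.Gamma a ≠ 0 := Complex.Gamma_ne_zero_of_re_pos ha
    rw [himg] at h
    rw [h, tricomiPsi, mul_assoc, mul_inv_cancel_left₀ hΓ, ← integral_const_mul]
    refine setIntegral_congr_fun measurableSet_Ioi fun t ht => ?_
    have ht' : (0 : ℝ) < t := ht
    have h2M : 0 < 2 * M := by positivity
    have h2M0 : ((2 * M : ℝ) : ℂ) ≠ 0 := by exact_mod_cast h2M.ne'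
    have h1t : 0 < 1 + t := by positivity
    have h1t0 : ((1 + t : ℝ) : ℂ) ≠ 0 := by exact_mod_cast h1t.ne'
    -- With v = M + 2Mt one has v - M = 2Mt and v + M = 2M(1 + t), the two factors of Tricomi's
    -- integrand.
    have e1 : (M + 2 * M * t) ^ 2 - M ^ 2 = (2 * M) * (2 * M) * (t * (1 + t)) := by ring
    have e2 : M + 2 * M * t + M = 2 * M * (1 + t) := by ring
    have e3 : -(ρ * (M + 2 * M * t)) = -(M * ρ) + -(2 * M * ρ * t) := by ring
    have e4 : 2 * a - 1 + p = (a - 1) + (a - 1) + (p : ℂ) + 1 := by ring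
    have e5 : 2 * a + p - a - 1 = (a - 1) + (p : ℂ) := by ring
    have e6 : ((2 * M * (2 * M) * (t * (1 + t)) : ℝ) : ℂ) ^ (a - 1) =
        ((2 * M : ℝ) : ℂ) ^ (a - 1) * ((2 * M : ℝ) : ℂ) ^ (a - 1) *
          ((t : ℂ) ^ (a - 1) * ((1 + t : ℝ) : ℂ) ^ (a - 1)) := by
      rw [Complex.ofReal_mul, Complex.mul_cpow_ofReal_nonneg (by positivity) (by positivity),
        Complex.ofReal_mul (2 * M), Complex.mul_cpow_ofReal_nonneg h2M.le h2M.le,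
        Complex.ofReal_mul t, Complex.mul_cpow_ofReal_nonneg ht'.le h1t.le]
    simp only [hg]
    rw [abs_of_pos h2M, Complex.real_smul, e1, e6, e2, e3, e4, e5, Real.exp_add,
      mul_pow (2 * M), Complex.cpow_add _ _ h2M0, Complex.cpow_add _ _ h2M0,
      Complex.cpow_add _ _ h2M0, Complex.cpow_add _ _ h1t0, Complex.cpow_natCast,
      Complex.cpow_natCast, Complex.cpow_one]
    push_cast
    ring

end

/-! ### Cosets of the parabolic subgroup and bottom rows. -/

noncomputable section

/-- The pairs `(c, d)` with `c ≥ 1`, `0 ≤ d < c` and `d` prime to `c`. -/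
abbrev ReducedPairs : Type :=
  Σ c : ℕ+, {d : ℕ // d ∈ (Finset.range c).filter (fun d => Nat.Coprime d c)}

/-- The fraction `d / c`. -/
def ratio (p : ReducedPairs) : ℝ := (p.2.1 : ℝ) / (p.1 : ℕ)

theorem exists_bottom_row {c d : ℤ} (h : IsCoprime c d) :
    ∃ g : SL(2, ℤ), g 1 0 = c ∧ g 1 1 = d := by
  obtain ⟨g, -, hg⟩ := ModularGroup.bottom_row_surj (R := ℤ) (a := ![c, d]) (by simpa using h)
  exact ⟨g, by simpa using congrFun hg 0, by simpa using congrFun hg 1⟩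

theorem isCoprime_bottom_row (p : ReducedPairs × ℤ) :
    IsCoprime (((p.1.1 : ℕ) : ℤ)) ((p.1.2.1 : ℤ) + (p.1.1 : ℕ) * p.2) := by
  have h : Nat.Coprime p.1.2.1 p.1.1 := (Finset.mem_filter.mp p.1.2.2).2
  exact (Nat.isCoprime_iff_coprime.mpr h).symm.add_mul_left_right p.2

/-- A matrix with bottom row `(c, d + cq)`. -/
def rowMatrix (p : ReducedPairs × ℤ) : SL(2, ℤ) := (exists_bottom_row (isCoprime_bottom_row p)).choose

theorem rowMatrix_spec (p : ReducedPairs × ℤ) :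
    rowMatrix p 1 0 = ((p.1.1 : ℕ) : ℤ) ∧
      rowMatrix p 1 1 = (p.1.2.1 : ℤ) + (p.1.1 : ℕ) * p.2 :=
  (exists_bottom_row (isCoprime_bottom_row p)).choose_spec

variable {n : ℕ}

/-- Up to sign, the lower left entry of δγ⁻¹ is the determinant of the two bottom rows. The
permutations drop out because the parabolic subgroup contains all of them. -/
theorem cosets_mk_eq_iff (γ δ : ModularGroup n) :
    (Quotient.mk _ γ : Cosets n) = Quotient.mk _ δ ↔
      γ.2 1 0 * δ.2 1 1 = γ.2 1 1 * δ.2 1 0 := by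
  rw [Quotient.eq, QuotientGroup.rightRel_apply]
  change (δ * γ⁻¹).2 1 0 = 0 ↔ _
  simp only [Prod.snd_mul, Prod.snd_inv, Matrix.SpecialLinearGroup.coe_mul,
    Matrix.SpecialLinearGroup.coe_inv, Matrix.adjugate_fin_two, Matrix.mul_apply,
    Fin.sum_univ_two, Matrix.of_apply, Matrix.cons_val', Matrix.cons_val_zero,
    Matrix.cons_val_one]
  simp
  constructor <;> intro h <;> linarith

/-- The parametrization of the cosets by bottom rows. -/
def cosetOf (n : ℕ) : Unit ⊕ (ReducedPairs × ℤ) → Cosets n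
  | Sum.inl _ => Quotient.mk _ 1
  | Sum.inr p => Quotient.mk _ (1, rowMatrix p)

theorem cosetOf_injective (n : ℕ) : Function.Injective (cosetOf n) := by
  rintro (⟨⟩ | p) (⟨⟩ | p') h
  · rfl
  · rw [cosetOf, cosetOf, cosets_mk_eq_iff] at h
    have hp := (rowMatrix_spec p').1
    simp only [Prod.snd_one, hp] at h
    simp at h
    exact absurd h.symm (by exact_mod_cast p'.1.1.ne_zero)
  · rw [cosetOf, cosetOf, cosets_mk_eq_iff] at h
    have hp := (rowMatrix_spec p).1
    simp only [Prod.snd_one, hp] at h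
    simp at h
  · rw [cosetOf, cosetOf, cosets_mk_eq_iff] at h
    obtain ⟨h1, h2⟩ := rowMatrix_spec p
    obtain ⟨h1', h2'⟩ := rowMatrix_spec p'
    have hc := isCoprime_bottom_row p
    have hc' := isCoprime_bottom_row p'
    simp only [h1, h2, h1', h2'] at h
    obtain ⟨⟨c, d, hd⟩, q⟩ := p
    obtain ⟨⟨c', d', hd'⟩, q'⟩ := p'
    simp only at *
    -- Proportional coprime rows with positive first entries have first entries dividing each other,
    -- so the rows agree.
    have e1 : ((c : ℕ) : ℤ) ∣ ((c' : ℕ) : ℤ) :=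
      hc.dvd_of_dvd_mul_left ⟨_, h.symm⟩
    have e2 : ((c' : ℕ) : ℤ) ∣ ((c : ℕ) : ℤ) :=
      hc'.dvd_of_dvd_mul_right ⟨_, h.trans (mul_comm _ _)⟩
    have e3 : c = c' := by
      apply PNat.coe_injective
      exact Nat.dvd_antisymm (Int.natCast_dvd_natCast.mp e1) (Int.natCast_dvd_natCast.mp e2)
    subst e3
    have hcpos : (0 : ℤ) < ((c : ℕ) : ℤ) := by exact_mod_cast c.pos
    have e4 : (d' : ℤ) + (c : ℕ) * q' = d + (c : ℕ) * q := by
      rw [mul_comm] at h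
      exact mul_right_cancel₀ hcpos.ne' h
    have hdlt := Finset.mem_range.mp (Finset.mem_filter.mp hd).1
    have hdlt' := Finset.mem_range.mp (Finset.mem_filter.mp hd').1
    -- Both residues lie in [0, c), so reduction modulo c recovers them.
    have e5 : (d' : ℤ) = d := by
      have := congrArg (· % ((c : ℕ) : ℤ)) e4
      simp only [Int.add_mul_emod_self_left] at this
      rwa [Int.emod_eq_of_lt (by positivity) (by exact_mod_cast hdlt'),
        Int.emod_eq_of_lt (by positivity) (by exact_mod_cast hdlt)] at this
    have e6 : d' = d := by exact_mod_cast e5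
    subst e6
    have e7 : q' = q := by
      have := add_left_cancel e4
      exact mul_left_cancel₀ hcpos.ne' this
    subst e7
    rfl

theorem exists_rowMatrix {c d : ℤ} (hc : 0 < c) (h : IsCoprime c d) :
    ∃ p : ReducedPairs × ℤ, rowMatrix p 1 0 = c ∧ rowMatrix p 1 1 = d := by
  have hmod : 0 ≤ d % c := Int.emod_nonneg _ hc.ne'
  have hlt : d % c < c := Int.emod_lt_of_pos _ hc
  obtain ⟨c₀, rfl⟩ := Int.eq_ofNat_of_zero_le hc.le
  obtain ⟨d₀, hd₀⟩ := Int.eq_ofNat_of_zero_le hmod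
  have hc₀ : 0 < c₀ := by exact_mod_cast hc
  have hcop : Nat.Coprime d₀ c₀ := by
    rw [← Nat.isCoprime_iff_coprime, ← hd₀]
    have : d % (c₀ : ℤ) = d + c₀ * (-(d / c₀)) := by
      have := Int.emod_add_mul_ediv d c₀
      linarith
    rw [this]
    exact (h.add_mul_left_right _).symm
  refine ⟨⟨⟨⟨c₀, hc₀⟩, d₀, ?_⟩, d / c₀⟩, ?_, ?_⟩
  · rw [hd₀] at hlt
    exact Finset.mem_filter.mpr ⟨Finset.mem_range.mpr (by exact_mod_cast hlt), hcop⟩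
  · exact (rowMatrix_spec _).1
  · rw [(rowMatrix_spec _).2]
    simp only [PNat.mk_coe]
    rw [← hd₀]
    exact Int.emod_add_mul_ediv d c₀

theorem cosetOf_surjective (n : ℕ) : Function.Surjective (cosetOf n) := by
  intro x
  induction x using Quotient.inductionOn with
  | h γ =>
    have hcop : IsCoprime (γ.2 1 0) (γ.2 1 1) := ModularGroup.bottom_row_coprime γ.2
    -- For c < 0 the negated row lies in the same coset; for c = 0 the coset is the trivial one.
    rcases lt_trichotomy (γ.2 1 0) 0 with h | h | h
    · obtain ⟨p, h1, h2⟩ := exists_rowMatrix (neg_pos.mpr h) hcop.neg_neg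
      refine ⟨Sum.inr p, ?_⟩
      rw [cosetOf, cosets_mk_eq_iff, h1, h2]
      ring
    · refine ⟨Sum.inl (), ?_⟩
      rw [cosetOf, cosets_mk_eq_iff, h]
      simp
    · obtain ⟨p, h1, h2⟩ := exists_rowMatrix h hcop
      refine ⟨Sum.inr p, ?_⟩
      rw [cosetOf, cosets_mk_eq_iff, h1, h2]
      ring

/-- The cosets `G(ℤ)_∞ \ G(ℤ)` are parametrized by the bottom rows up to sign. -/
def cosetsEquiv (n : ℕ) : Unit ⊕ (ReducedPairs × ℤ) ≃ Cosets n :=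
  Equiv.ofBijective (cosetOf n) ⟨cosetOf_injective n, cosetOf_surjective n⟩

theorem rho_pos (Z : SiegelDomain n) : 0 < rho Z := sub_pos.mpr Z.sum_lt

theorem beta_nonneg (Z : SiegelDomain n) : 0 ≤ beta Z :=
  Finset.sum_nonneg fun _ _ => Complex.normSq_nonneg _

theorem rho_add_beta (Z : SiegelDomain n) : rho Z + beta Z = Z.w.im := by
  rw [rho, beta]; ring

/-- As ρ and β scale by the same factor, λ and μ affect the dependence on γ only through λ + μ. -/
theorem phi_smul (lam mu : ℂ) (Z : SiegelDomain n)
    (γ : ModularGroup n) :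
    phi lam mu (γ • Z) = (rho Z : ℂ) ^ lam * (beta Z : ℂ) ^ mu *
      (Complex.normSq (mobDen γ.2 Z.w) : ℂ) ^ (-(lam + mu)) := by
  have hN : 0 < Complex.normSq (mobDen γ.2 Z.w) := Complex.normSq_pos.mpr (den_ne_zero _ Z.im_pos)
  have hN0 : (Complex.normSq (mobDen γ.2 Z.w) : ℂ) ≠ 0 := by exact_mod_cast hN.ne'
  have hdiv : ∀ {x : ℝ} (hx : 0 ≤ x) (μ : ℂ),
      ((x / Complex.normSq (mobDen γ.2 Z.w) : ℝ) : ℂ) ^ μ =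
        (x : ℂ) ^ μ * (Complex.normSq (mobDen γ.2 Z.w) : ℂ) ^ (-μ) := by
    intro x hx μ
    rw [div_eq_mul_inv, Complex.ofReal_mul,
      Complex.mul_cpow_ofReal_nonneg hx (inv_nonneg.mpr hN.le), Complex.ofReal_inv,
      Complex.inv_cpow, Complex.cpow_neg]
    rw [Complex.arg_ofReal_of_nonneg hN.le]
    exact Real.pi_pos.ne
  rw [phi, rho_smul, beta_smul, hdiv (rho_pos Z).le, hdiv (beta_nonneg Z), neg_add,
    Complex.cpow_add _ _ hN0]
  ring

theorem normSq_mobDen_rowMatrix (p : ReducedPairs × ℤ) {w : ℂ} (hw : 0 < w.im) (κ : ℂ) :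
    (Complex.normSq (mobDen (rowMatrix p) w) : ℂ) ^ (-κ) =
      1 / (((p.1.1 : ℕ) : ℂ) ^ (2 * κ)) *
        poissonFun κ w.im (w.re + ratio p.1 + p.2) := by
  obtain ⟨h1, h2⟩ := rowMatrix_spec p
  have hc : (0 : ℝ) < ((p.1.1 : ℕ) : ℝ) := by exact_mod_cast p.1.1.pos
  have e1 : Complex.normSq (mobDen (rowMatrix p) w) =
      ((p.1.1 : ℕ) : ℝ) ^ 2 * ((w.re + ratio p.1 + p.2) ^ 2 + w.im ^ 2) := by
    rw [ratio, mobDen, h1, h2, Complex.normSq_apply]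
    simp
    field_simp
    ring
  rw [e1, Complex.ofReal_mul, Complex.mul_cpow_ofReal_nonneg (by positivity) (by positivity),
    poissonFun]
  congr 1
  rw [show 2 * κ = ((2 : ℕ) : ℂ) * κ by push_cast; ring, Complex.cpow_nat_mul, pow_two,
    Complex.ofReal_mul, Complex.mul_cpow_ofReal_nonneg hc.le hc.le, Complex.cpow_neg]
  push_cast
  rw [pow_two, one_div, mul_inv]

end

/-! ### Absolute convergence and the Fourier expansion of the Eisenstein series. -/

noncomputable section

theorem norm_one_div_natCast_cpow (c : ℕ+) (κ : ℂ) :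
    ‖(1 : ℂ) / (((c : ℕ) : ℂ) ^ (2 * κ))‖ = ((c : ℕ) : ℝ) ^ (-(2 * κ.re)) := by
  have hc : (0 : ℝ) < ((c : ℕ) : ℝ) := by exact_mod_cast c.pos
  rw [norm_div, norm_one, ← Complex.ofReal_natCast, norm_ofReal_cpow hc, Real.rpow_neg hc.le, one_div]
  simp

/-- There are at most c residues for each c, so the sum is dominated by that of c^{1-2σ}. -/
theorem summable_reducedPairs {σ : ℝ} (hσ : 1 < σ) :
    Summable fun p : ReducedPairs => ((p.1 : ℕ) : ℝ) ^ (-(2 * σ)) := by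
  rw [summable_sigma_of_nonneg fun p => by positivity]
  refine ⟨fun c => Summable.of_finite, ?_⟩
  have h0 : Summable fun c : ℕ+ => ((c : ℕ) : ℝ) ^ (1 - 2 * σ) :=
    (Real.summable_nat_rpow.mpr (by linarith)).comp_injective PNat.coe_injective
  refine Summable.of_nonneg_of_le (fun c => tsum_nonneg fun _ => by positivity) (fun c => ?_) h0
  have hc : (0 : ℝ) < ((c : ℕ) : ℝ) := by exact_mod_cast c.pos
  simp only
  rw [tsum_fintype, Finset.sum_const, nsmul_eq_mul, sub_eq_add_neg, Real.rpow_add hc, Real.rpow_one]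
  gcongr
  rw [Finset.card_univ, Fintype.card_coe]
  exact (Finset.card_filter_le _ _).trans (by simp)

/-- The summand of `φ_m(κ)` at a reduced pair. -/
def pairTerm (m : ℤ) (κ : ℂ) (p : ReducedPairs) : ℂ :=
  1 / (((p.1 : ℕ) : ℂ) ^ (2 * κ)) * e (m * (p.2.1 : ℕ) / (p.1 : ℕ))

theorem norm_pairTerm (m : ℤ) (κ : ℂ) (p : ReducedPairs) :
    ‖pairTerm m κ p‖ = ((p.1 : ℕ) : ℝ) ^ (-(2 * κ.re)) := by
  rw [pairTerm, norm_mul, norm_e, mul_one, norm_one_div_natCast_cpow]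

theorem summable_pairTerm (m : ℤ) {κ : ℂ} (hκ : 1 < κ.re) : Summable (pairTerm m κ) := by
  refine Summable.of_norm ?_
  simpa only [norm_pairTerm] using summable_reducedPairs hκ

theorem tsum_fibre_pairTerm (m : ℤ) (κ : ℂ) (c : ℕ+) :
    ∑' d, pairTerm m κ ⟨c, d⟩ = varphiTerm m κ c := by
  simp only [pairTerm]
  rw [tsum_mul_left, varphiTerm]
  congr 1
  exact Finset.tsum_subtype ((Finset.range c).filter (fun d => Nat.Coprime d c))
    (fun d : ℕ => e (m * d / (c : ℕ)))

theorem summable_varphiTerm (m : ℤ) {κ : ℂ} (hκ : 1 < κ.re) : Summable (varphiTerm m κ) := by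
  simpa only [tsum_fibre_pairTerm] using (summable_pairTerm m hκ).sigma

theorem tsum_pairTerm (m : ℤ) {κ : ℂ} (hκ : 1 < κ.re) : ∑' p, pairTerm m κ p = varphi m κ := by
  rw [(summable_pairTerm m hκ).tsum_sigma, varphi]
  exact tsum_congr fun c => tsum_fibre_pairTerm m κ c

/-- The term of the Eisenstein series with bottom row `(c, d + cq)`. -/
def rowTerm (κ : ℂ) (y t : ℝ) (p : ReducedPairs × ℤ) : ℂ :=
  1 / (((p.1.1 : ℕ) : ℂ) ^ (2 * κ)) * poissonFun κ y (t + ratio p.1 + p.2)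

/-- The norms form the same series with κ replaced by Re κ, and Poisson summation bounds it
uniformly in x. This uniformity lets the shifts d/c be summed. -/
theorem tsum_norm_poissonFun_le {κ : ℂ} (hκ : 1 / 2 < κ.re) {y : ℝ} (hy : 0 < y) (x : ℝ) :
    ∑' q : ℤ, ‖poissonFun κ y (x + q)‖ ≤ ∑' m : ℤ, ‖poissonCoeff κ.re y m‖ := by
  have hre : 1 / 2 < (κ.re : ℂ).re := by simpa using hκ
  have e1 : ∀ t, ((‖poissonFun κ y t‖ : ℝ) : ℂ) = poissonFun κ.re y t := by
    intro t
    rw [norm_poissonFun hy, poissonFun, Complex.ofReal_cpow (by positivity)]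
    push_cast
    rfl
  have hs : Summable fun m : ℤ => poissonCoeff κ.re y m * e (m * x) := by
    refine Summable.of_norm ?_
    simpa only [norm_mul, norm_e, mul_one] using (summable_poissonCoeff hre hy).norm
  have h0 : (0 : ℝ) ≤ ∑' q : ℤ, ‖poissonFun κ y (x + q)‖ := tsum_nonneg fun _ => norm_nonneg _
  calc ∑' q : ℤ, ‖poissonFun κ y (x + q)‖
      = ‖((∑' q : ℤ, ‖poissonFun κ y (x + q)‖ : ℝ) : ℂ)‖ := by
        rw [Complex.norm_real, Real.norm_of_nonneg h0]
    _ = ‖∑' m : ℤ, poissonCoeff κ.re y m * e (m * x)‖ := by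
        rw [Complex.ofReal_tsum]
        simp only [e1]
        rw [tsum_poissonFun_add hre hy]
    _ ≤ ∑' m : ℤ, ‖poissonCoeff κ.re y m * e (m * x)‖ := norm_tsum_le_tsum_norm hs.norm
    _ = _ := by simp only [norm_mul, norm_e, mul_one]

theorem summable_rowTerm {κ : ℂ} (hκ : 1 < κ.re) {y : ℝ} (hy : 0 < y) (t : ℝ) :
    Summable (rowTerm κ y t) := by
  have hκ2 : 1 / 2 < κ.re := by linarith
  have h0 : 0 ≤ fun p : ReducedPairs × ℤ => ‖rowTerm κ y t p‖ := fun p => norm_nonneg _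
  refine Summable.of_norm ((summable_prod_of_nonneg h0).mpr ⟨fun a => ?_, ?_⟩)
  · simp only [rowTerm, norm_mul]
    exact (summable_poissonFun_add hκ2 hy _).norm.mul_left _
  · simp only [rowTerm, norm_mul, norm_one_div_natCast_cpow, tsum_mul_left]
    refine Summable.of_nonneg_of_le
      (fun a => mul_nonneg (by positivity) (tsum_nonneg fun _ => norm_nonneg _)) (fun a => ?_)
      ((summable_reducedPairs hκ).mul_right (∑' m : ℤ, ‖poissonCoeff κ.re y m‖))
    exact mul_le_mul_of_nonneg_left (tsum_norm_poissonFun_le hκ2 hy _) (by positivity)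

/-- The Fourier expansion of the sum over the bottom rows with `c > 0`. -/
theorem hasSum_tsum_rowTerm {κ : ℂ} (hκ : 1 < κ.re) {y : ℝ} (hy : 0 < y) (t : ℝ) :
    HasSum (fun m : ℤ => varphi m κ * poissonCoeff κ y m * e (m * t))
      (∑' p, rowTerm κ y t p) := by
  have hκ2 : 1 / 2 < κ.re := by linarith
  -- An absolutely convergent double series summed in two orders: over m first it gives the row sums
  -- by Poisson, over the reduced pairs first it gives φ_m(κ).
  set G : ReducedPairs × ℤ → ℂ := fun p =>
    pairTerm p.2 κ p.1 * (poissonCoeff κ y p.2 * e (p.2 * t)) with hG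
  have hGs : Summable G := by
    refine Summable.of_norm ?_
    have := (summable_reducedPairs hκ).mul_of_nonneg (summable_poissonCoeff hκ2 hy).norm
      (fun _ => by positivity) (fun _ => norm_nonneg _)
    simpa only [hG, norm_mul, norm_pairTerm, norm_e, mul_one] using this
  have hGsum : ∑' p, G p = ∑' p, rowTerm κ y t p := by
    rw [hGs.tsum_prod, (summable_rowTerm hκ hy t).tsum_prod]
    refine tsum_congr fun a => ?_
    simp only [rowTerm]
    refine Eq.trans ?_ tsum_mul_left.symm
    refine Eq.trans ?_ (congrArg _ (tsum_poissonFun_add hκ2 hy _).symm)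
    refine Eq.trans ?_ tsum_mul_left
    refine tsum_congr fun m => ?_
    simp only [hG]
    rw [pairTerm, ratio, mul_add, e_add, mul_div_assoc]
    ring
  have hsw : HasSum (fun p : ℤ × ReducedPairs => G p.swap) (∑' p, rowTerm κ y t p) := by
    rw [← hGsum]
    exact (Equiv.prodComm ℤ ReducedPairs).hasSum_iff.mpr hGs.hasSum
  refine hsw.prod_fiberwise fun m => ?_
  simp only [hG, Prod.swap_prod_mk]
  rw [mul_assoc, ← tsum_pairTerm m hκ]
  exact (summable_pairTerm m hκ).hasSum.mul_right _

/-- The Fourier coefficient `ρ^λ β^μ (δ_{0,m} + φ_m(λ+μ) ∫ (t² + (ρ+β)²)^{-λ-μ} e(-mt) dt)`. -/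
def eisCoeff (lam mu : ℂ) (m : ℤ) (ρ β : ℝ) : ℂ :=
  (ρ : ℂ) ^ lam * (β : ℂ) ^ mu *
    ((if m = 0 then 1 else 0) + varphi m (lam + mu) * poissonCoeff (lam + mu) (ρ + β) m)

variable {n : ℕ}

/-- The 1 is the coset with c = 0; all other cosets are the rows with c > 0. -/
theorem hasSum_eisTerm {lam mu : ℂ} (hre : 1 < (lam + mu).re) (Z : SiegelDomain n) :
    HasSum (eisTerm lam mu Z) ((rho Z : ℂ) ^ lam * (beta Z : ℂ) ^ mu *
      (1 + ∑' p, rowTerm (lam + mu) Z.w.im Z.w.re p)) := by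
  rw [← (cosetsEquiv n).hasSum_iff, mul_add]
  refine HasSum.sum ?_ ?_
  · have e1 : ∀ x, ((eisTerm lam mu Z ∘ cosetsEquiv n) ∘ Sum.inl) x =
        (rho Z : ℂ) ^ lam * (beta Z : ℂ) ^ mu * 1 := by
      intro x
      change phi lam mu ((1 : ModularGroup n) • Z) = _
      rw [one_smul, phi, mul_one]
    convert hasSum_unique ((eisTerm lam mu Z ∘ cosetsEquiv n) ∘ Sum.inl) using 1
    rw [e1]
  · have e1 : (eisTerm lam mu Z ∘ cosetsEquiv n) ∘ Sum.inr = fun p =>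
        (rho Z : ℂ) ^ lam * (beta Z : ℂ) ^ mu * rowTerm (lam + mu) Z.w.im Z.w.re p := by
      ext p
      change phi lam mu (((1, rowMatrix p) : ModularGroup n) • Z) = _
      rw [phi_smul, normSq_mobDen_rowMatrix p Z.im_pos, rowTerm]
    rw [e1]
    exact (summable_rowTerm hre Z.im_pos _).hasSum.mul_left _

theorem hasSum_eisCoeff {lam mu : ℂ} (hre : 1 < (lam + mu).re) (Z : SiegelDomain n) :
    HasSum (fun m : ℤ => eisCoeff lam mu m (rho Z) (beta Z) * e (m * tt Z))
      (eisenstein lam mu Z) := by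
  rw [eisenstein, (hasSum_eisTerm hre Z).tsum_eq]
  have h1 := hasSum_tsum_rowTerm hre Z.im_pos Z.w.re
  have h2 : HasSum (fun m : ℤ => if m = 0 then (1 : ℂ) else 0) 1 := hasSum_ite_eq 0 1
  convert! (h2.add h1).mul_left ((rho Z : ℂ) ^ lam * (beta Z : ℂ) ^ mu) using 1
  ext m
  rw [eisCoeff, rho_add_beta, tt]
  split_ifs with hm
  · subst hm
    simp [e]
  · ring

theorem integral_e_mul_e (k m : ℤ) :
    ∫ t in (0 : ℝ)..1, e (k * t) * e (-(m * t)) = if k = m then 1 else 0 := by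
  have h1 : ∀ t : ℝ, e (k * t) * e (-(m * t)) =
      Complex.exp (2 * Real.pi * Complex.I * ((k - m : ℤ) : ℂ) * t) := by
    intro t
    rw [← e_add, e]
    push_cast
    ring_nf
  simp only [h1]
  split_ifs with h
  · subst h
    simp
  · have hkm : ((k - m : ℤ) : ℂ) ≠ 0 := by exact_mod_cast sub_ne_zero.mpr h
    have hc : 2 * Real.pi * Complex.I * ((k - m : ℤ) : ℂ) ≠ 0 :=
      mul_ne_zero Complex.two_pi_I_ne_zero hkm
    rw [integral_exp_mul_complex hc]
    simp only [Complex.ofReal_one, Complex.ofReal_zero, mul_one, mul_zero, Complex.exp_zero]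
    rw [mul_comm, Complex.exp_int_mul_two_pi_mul_I, sub_self, zero_div]

/-- The coefficients of an absolutely convergent Fourier expansion. -/
theorem integral_mul_e_of_hasSum {a : ℤ → ℂ} {f : ℝ → ℂ} (ha : Summable a)
    (hf : ∀ t, HasSum (fun m : ℤ => a m * e (m * t)) (f t)) (m : ℤ) :
    ∫ t in (0 : ℝ)..1, f t * e (-(m * t)) = a m := by
  have hce := continuous_e
  have h := intervalIntegral.hasSum_integral_of_dominated_convergence (μ := volume)
    (a := 0) (b := 1) (F := fun (k : ℤ) (t : ℝ) => a k * e (k * t) * e (-(m * t)))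
    (f := fun t => f t * e (-(m * t))) (fun k _ => ‖a k‖) (fun k => by
      refine Continuous.aestronglyMeasurable ?_
      fun_prop)
    (fun k => Filter.Eventually.of_forall fun t _ => by
      rw [norm_mul, norm_mul, norm_e, norm_e, mul_one, mul_one])
    (Filter.Eventually.of_forall fun t _ => ha.norm) (by simp)
    (Filter.Eventually.of_forall fun t _ => (hf t).mul_right _)
  have h2 : ∀ k : ℤ, ∫ t in (0 : ℝ)..1, a k * e (k * t) * e (-(m * t)) =
      if k = m then a m else 0 := by
    intro k
    simp only [mul_assoc]
    rw [intervalIntegral.integral_const_mul, integral_e_mul_e]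
    split_ifs with hk
    · rw [hk, mul_one]
    · rw [mul_zero]
  simp only [h2] at h
  exact h.unique (hasSum_ite_eq m (a m))

theorem integral_eisenstein_mul_e {lam mu : ℂ} (hre : 1 < (lam + mu).re) (m : ℤ) (z : Fin n → ℂ)
    {ρ : ℝ} (hρ : 0 < ρ) :
    eisCoeff lam mu m ρ (∑ j, Complex.normSq (z j)) =
      ∫ t in (0 : ℝ)..1, eisenstein lam mu (ofCoords z t ρ hρ) * e (-(m * t)) := by
  have hsum : ∀ t, HasSum
      (fun m : ℤ => eisCoeff lam mu m ρ (∑ j, Complex.normSq (z j)) * e (m * t))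
      (eisenstein lam mu (ofCoords z t ρ hρ)) := by
    intro t
    have := hasSum_eisCoeff hre (ofCoords z t ρ hρ)
    have e1 : rho (ofCoords z t ρ hρ) = ρ := by simp [rho, ofCoords]
    rw [e1] at this
    exact this
  -- At t = 0 every character equals 1, so the expansion there is the series of coefficients itself.
  have ha : Summable fun m : ℤ => eisCoeff lam mu m ρ (∑ j, Complex.normSq (z j)) := by
    have := (hsum 0).summable
    simpa [e] using this
  exact (integral_mul_e_of_hasSum ha hsum m).symm

end

/-! ### Constants, and evaluation of the two transforms. -/

noncomputable section

/-- Once all powers of 2, π, |m| and ρ are exponentials of logarithms, comparing constants reduces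
to one linear identity between exponents. -/
theorem ofReal_cpow_eq_exp {x : ℝ} (hx : 0 < x) (w : ℂ) :
    (x : ℂ) ^ w = Complex.exp ((Real.log x : ℂ) * w) := by
  rw [Complex.cpow_def_of_ne_zero (by exact_mod_cast hx.ne'), Complex.ofReal_log hx.le]

theorem ofReal_eq_exp_log {x : ℝ} (hx : 0 < x) : (x : ℂ) = Complex.exp (Real.log x : ℂ) := by
  rw [← Complex.ofReal_exp, Real.exp_log hx]

theorem sqrt_pi_eq_exp : (Real.sqrt Real.pi : ℂ) = Complex.exp ((Real.log Real.pi : ℂ) * (1 / 2)) := by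
  rw [← ofReal_cpow_eq_exp Real.pi_pos, Real.sqrt_eq_rpow, Complex.ofReal_cpow Real.pi_pos.le]
  push_cast
  rfl

theorem two_cpow_eq_exp (w : ℂ) : (2 : ℂ) ^ w = Complex.exp ((Real.log 2 : ℂ) * w) := by
  simpa using ofReal_cpow_eq_exp (x := 2) (by norm_num) w

theorem two_zpow_eq_exp (k : ℤ) : (2 : ℂ) ^ k = Complex.exp ((Real.log 2 : ℂ) * k) := by
  rw [← two_cpow_eq_exp, Complex.cpow_intCast]

theorem four_cpow_eq_exp (w : ℂ) : (4 : ℂ) ^ w = Complex.exp ((Real.log 2 : ℂ) * (2 * w)) := by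
  rw [← two_cpow_eq_exp, show (2 * w : ℂ) = ((2 : ℕ) : ℂ) * w by push_cast; ring,
    Complex.cpow_nat_mul, sq, show (4 : ℂ) = ((2 : ℝ) : ℂ) * ((2 : ℝ) : ℂ) by norm_num,
    Complex.mul_cpow_ofReal_nonneg (by norm_num) (by norm_num), Complex.ofReal_ofNat]

theorem two_eq_exp : (2 : ℂ) = Complex.exp (Real.log 2 : ℂ) := by
  simpa using ofReal_eq_exp_log (x := 2) (by norm_num)

/-- The constant in front of `K_ν`. -/
theorem laplaceKernel_eq_besselK {s : ℂ} (hs : 0 < s.re) {μ ρ : ℝ} (hμ : 0 < μ) (hρ : 0 < ρ) :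
    laplaceKernel s ρ (2 * Real.pi * μ) = Complex.Gamma s *
      Complex.exp ((Real.log 2 : ℂ) * (2 * s - 1) + (Real.log Real.pi : ℂ) * (s - 1) +
        (Real.log μ : ℂ) * (s - 1 / 2) - (Real.log ρ : ℂ) * (s - 1 / 2)) *
      besselK (s - 1 / 2) (2 * Real.pi * μ * ρ) := by
  have hM : 0 < 2 * Real.pi * μ := by have := Real.pi_pos; positivity
  have e1 : 2 * Real.pi * μ / (2 * ρ) = Real.pi * μ / ρ := by field_simp
  have hlog : Real.log (Real.pi * μ / ρ) = Real.log Real.pi + Real.log μ - Real.log ρ := by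
    rw [Real.log_div (by have := Real.pi_pos; positivity) hρ.ne',
      Real.log_mul Real.pi_pos.ne' hμ.ne']
  have hx : 0 < Real.pi * μ / ρ := by have := Real.pi_pos; positivity
  have h2 : (Complex.exp ((Real.log 2 : ℂ) * (2 * s - 1) + (Real.log Real.pi : ℂ) * (s - 1) +
        (Real.log μ : ℂ) * (s - 1 / 2) - (Real.log ρ : ℂ) * (s - 1 / 2))) =
      Complex.exp ((Real.log 2 : ℂ) * (2 * (s - 1))) *
        Complex.exp (-((Real.log Real.pi : ℂ) * (1 / 2))) * (Complex.exp (Real.log 2 : ℂ) *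
        Complex.exp (((Real.log Real.pi + Real.log μ - Real.log ρ : ℝ) : ℂ) * (s - 1 / 2))) := by
    rw [← Complex.exp_add, ← Complex.exp_add, ← Complex.exp_add]
    congr 1
    push_cast
    ring
  rw [(laplaceKernel_eq hρ hM.le hs (Or.inl hM.ne')).2, besselKernel_eq_besselK s hρ hM, e1,
    ofReal_cpow_eq_exp hx, hlog, sqrt_pi_eq_exp, ← Complex.exp_neg, four_cpow_eq_exp, h2,
    ← two_eq_exp]
  ring

/-- The factor `ρ^λ φ_m(κ) π 4^{1-κ} Γ(κ)⁻²` that relates the coefficients to the Laplace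
kernel. -/
def coeffFactor (lam κ : ℂ) (m : ℤ) (ρ : ℝ) : ℂ :=
  (ρ : ℂ) ^ lam * varphi m κ * (Real.pi * (4 : ℂ) ^ (1 - κ) * (Complex.Gamma κ ^ 2)⁻¹)

theorem re_sub_natCast_div_two (s : ℂ) (n : ℕ) : (s - n / 2).re = s.re - n / 2 := by
  rw [show (n : ℂ) / 2 = (((n : ℝ) / 2 : ℝ) : ℂ) by push_cast; rfl, Complex.sub_re,
    Complex.ofReal_re]

variable {n : ℕ}

theorem integrandA_eq {s : ℂ} (hs : 1 < s.re) (m : ℤ) {ρ : ℝ} (hρ : 0 < ρ) {b : Fin n → ℝ}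
    (hb : b ∈ Set.univ.pi fun _ : Fin n => Ioi (0 : ℝ)) :
    integrandA (eisCoeff s 0) s m ρ b = coeffFactor s s m ρ *
      (laplaceKernel s (ρ + ∑ j, b j) (2 * Real.pi * |(m : ℝ)|) *
        ((∏ j, weight (1 / 2) 0 (2 * Real.pi * |(m : ℝ)|) (b j) : ℝ) : ℂ)) := by
  have hβ : 0 ≤ ∑ j, b j := Finset.sum_nonneg fun j _ => le_of_lt (hb j (mem_univ j))
  simp only [integrandA, exp_mul_seriesG]
  rw [Complex.ofReal_prod, ← mul_assoc]
  congr 1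
  rw [eisCoeff, add_zero, Complex.cpow_zero, poissonCoeff_eq_laplaceKernel (by linarith)
    (by linarith), coeffFactor]
  -- For m = 0 the Kronecker term of the coefficient cancels against the subtracted ρ^s.
  split_ifs <;> ring

theorem integral_integrandA {s : ℂ} (hs : 1 < s.re) (m : ℤ) {ρ : ℝ} (hρ : 0 < ρ)
    (hsn : (n : ℝ) / 2 < s.re) (h : m ≠ 0 ∨ ((n : ℝ) + 1) / 2 < s.re) :
    IntegrableOn (integrandA (n := n) (eisCoeff s 0) s m ρ) (Set.univ.pi fun _ => Ioi 0) ∧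
    ∫ b in Set.univ.pi (fun _ : Fin n => Ioi (0 : ℝ)), integrandA (eisCoeff s 0) s m ρ b =
      coeffFactor s s m ρ * laplaceKernel (s - n / 2) ρ (2 * Real.pi * |(m : ℝ)|) := by
  have hπ := Real.pi_pos
  have hM : 0 ≤ 2 * Real.pi * |(m : ℝ)| := by positivity
  have h' : 2 * Real.pi * |(m : ℝ)| ≠ 0 ∨ ((n : ℝ) + 1) / 2 < s.re := by
    refine h.imp (fun h => ?_) id
    have : (m : ℝ) ≠ 0 := by exact_mod_cast h
    positivity
  have key := integral_laplaceKernel_mul_prod_weight (n := n) hρ hM hsn h'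
  have hms : MeasurableSet (Set.univ.pi fun _ : Fin n => Ioi (0 : ℝ)) :=
    MeasurableSet.univ_pi fun _ => measurableSet_Ioi
  have hcongr := fun (b : Fin n → ℝ) hb => integrandA_eq (n := n) hs m hρ (b := b) hb
  constructor
  · exact (integrableOn_congr_fun hcongr hms).mpr (key.1.const_mul _)
  · rw [setIntegral_congr_fun hms hcongr, integral_const_mul, key.2]

theorem integral_integrandA_of_ne_zero {s : ℂ} (hs : 1 < s.re) {m : ℤ} (hm : m ≠ 0) {ρ : ℝ}
    (hρ : 0 < ρ) (hsn : (n : ℝ) / 2 < s.re) :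
    ∫ b in Set.univ.pi (fun _ : Fin n => Ioi (0 : ℝ)), integrandA (eisCoeff s 0) s m ρ b =
      (2 : ℂ) ^ (1 - (n : ℤ)) * (Real.pi : ℂ) ^ (s - n / 2) *
        (Complex.Gamma (s - n / 2) / Complex.Gamma s ^ 2) * varphi m s *
        ((|(m : ℝ)| : ℝ) : ℂ) ^ (s - (n + 1) / 2) * (ρ : ℂ) ^ (((n : ℂ) + 1) / 2) *
        besselK (s - (n + 1) / 2) (2 * Real.pi * |(m : ℝ)| * ρ) := by
  have hμ : 0 < |(m : ℝ)| := abs_pos.mpr (by exact_mod_cast hm)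
  have hre : 0 < (s - n / 2).re := by rw [re_sub_natCast_div_two]; linarith
  rw [(integral_integrandA hs m hρ hsn (Or.inl hm)).2, coeffFactor,
    laplaceKernel_eq_besselK hre hμ hρ, show s - n / 2 - 1 / 2 = s - (n + 1) / 2 by ring,
    ofReal_cpow_eq_exp hρ, ofReal_cpow_eq_exp hρ, ofReal_cpow_eq_exp hμ,
    ofReal_cpow_eq_exp Real.pi_pos, four_cpow_eq_exp, two_zpow_eq_exp,
    ofReal_eq_exp_log Real.pi_pos]
  have e1 : Complex.exp ((Real.log ρ : ℂ) * s) * Complex.exp (Real.log Real.pi : ℂ) *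
      Complex.exp ((Real.log 2 : ℂ) * (2 * (1 - s))) *
      Complex.exp ((Real.log 2 : ℂ) * (2 * (s - n / 2) - 1) +
        (Real.log Real.pi : ℂ) * (s - n / 2 - 1) +
        (Real.log |(m : ℝ)| : ℂ) * (s - (n + 1) / 2) - (Real.log ρ : ℂ) * (s - (n + 1) / 2)) =
      Complex.exp ((Real.log 2 : ℂ) * ((1 - (n : ℤ) : ℤ) : ℂ)) *
      Complex.exp ((Real.log Real.pi : ℂ) * (s - n / 2)) *
      Complex.exp ((Real.log |(m : ℝ)| : ℂ) * (s - (n + 1) / 2)) *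
      Complex.exp ((Real.log ρ : ℂ) * (((n : ℂ) + 1) / 2)) := by
    simp only [← Complex.exp_add]
    congr 1
    push_cast
    ring
  rw [div_eq_mul_inv _ (Complex.Gamma _ ^ 2)]
  linear_combination (varphi m s * (Complex.Gamma s ^ 2)⁻¹ * Complex.Gamma (s - n / 2) *
    besselK (s - (n + 1) / 2) (2 * Real.pi * |(m : ℝ)| * ρ)) * e1

theorem integral_integrandA_zero {s : ℂ} (hs : 1 < s.re) {ρ : ℝ}
    (hρ : 0 < ρ) (hsn : ((n : ℝ) + 1) / 2 < s.re) :
    ∫ b in Set.univ.pi (fun _ : Fin n => Ioi (0 : ℝ)), integrandA (eisCoeff s 0) s 0 ρ b =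
      (2 : ℂ) ^ (-(n : ℤ)) * (Real.sqrt Real.pi : ℂ) *
        (Complex.Gamma (s - n / 2) * Complex.Gamma (s - (n + 1) / 2) / Complex.Gamma s ^ 2) *
        varphi 0 s * (ρ : ℂ) ^ ((n : ℂ) + 1 - s) := by
  have hre : 1 / 2 < (s - n / 2).re := by rw [re_sub_natCast_div_two]; linarith
  -- Legendre duplication converts Γ(2(s - n/2) - 1), from the kernel at M = 0, into the product of
  -- two Gamma values.
  have hdup := Complex.Gamma_mul_Gamma_add_half (s - (n + 1) / 2)
  rw [show s - (n + 1) / 2 + 1 / 2 = s - n / 2 by ring,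
    show 2 * (s - (n + 1) / 2) = 2 * (s - n / 2) - 1 by ring, mul_comm] at hdup
  rw [(integral_integrandA hs 0 hρ (by linarith) (Or.inr hsn)).2, coeffFactor, hdup]
  simp only [Int.cast_zero, abs_zero, mul_zero]
  rw [laplaceKernel_zero hre hρ, ofReal_cpow_eq_exp hρ, ofReal_cpow_eq_exp hρ,
    ofReal_cpow_eq_exp hρ, four_cpow_eq_exp, two_zpow_eq_exp, two_cpow_eq_exp,
    sqrt_pi_eq_exp, ofReal_eq_exp_log Real.pi_pos]
  have e1 : Complex.exp ((Real.log ρ : ℂ) * s) * Complex.exp (Real.log Real.pi : ℂ) *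
      Complex.exp ((Real.log 2 : ℂ) * (2 * (1 - s))) *
      Complex.exp ((Real.log ρ : ℂ) * (1 - 2 * (s - n / 2))) =
      Complex.exp ((Real.log 2 : ℂ) * ((-(n : ℤ) : ℤ) : ℂ)) *
      Complex.exp ((Real.log Real.pi : ℂ) * (1 / 2)) *
      Complex.exp ((Real.log Real.pi : ℂ) * (1 / 2)) *
      Complex.exp ((Real.log 2 : ℂ) * (1 - (2 * (s - n / 2) - 1))) *
      Complex.exp ((Real.log ρ : ℂ) * ((n : ℂ) + 1 - s)) := by
    simp only [← Complex.exp_add]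
    congr 1
    push_cast
    ring
  rw [div_eq_mul_inv _ (Complex.Gamma _ ^ 2)]
  linear_combination (varphi 0 s * (Complex.Gamma s ^ 2)⁻¹ *
    Complex.Gamma (2 * (s - n / 2) - 1)) * e1

theorem re_sub_natCast_add_one (s : ℂ) (n : ℕ) : (s - n + 1).re = s.re - n + 1 := by simp

/-- The Laplace kernel integrated against `weight` for `α = 1 - n/2`, `N = n - 1`. -/
theorem integral_laplaceKernel_mul_weight (hn : 1 ≤ n) {s : ℂ} (hs : (n : ℝ) < s.re) {ρ M : ℝ}
    (hρ : 0 < ρ) (hM : 0 < M) :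
    IntegrableOn (fun β => laplaceKernel (s - n + 1) (ρ + β) M *
      (weight (1 - n / 2) (n - 1) M β : ℂ)) (Ioi 0) ∧
    ∫ β in Ioi (0 : ℝ), laplaceKernel (s - n + 1) (ρ + β) M *
      (weight (1 - n / 2) (n - 1) M β : ℂ) = laplaceKernel (s - n / 2) ρ M -
        ∑ k ∈ Finset.range (n - 1), ((poch (1 - n / 2) k / (k.factorial : ℝ) : ℝ) : ℂ) *
          ((Real.exp (-(M * ρ)) : ℂ) * ((2 * M : ℝ) : ℂ) ^ (2 * s - n - 1) *
            Complex.Gamma (s - n + 1) * tricomiPsi (s - n + 1) (2 * s - n - k) (2 * M * ρ)) := by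
  have hn' : (1 : ℝ) ≤ n := by exact_mod_cast hn
  have hα : (0 : ℝ) < (1 - n / 2) + ((n - 1 : ℕ) : ℝ) := by push_cast [hn]; linarith
  have hre : 0 < (s - n + 1).re := by rw [re_sub_natCast_add_one]; linarith
  have hre2 : 0 < (s - n / 2).re := by rw [re_sub_natCast_div_two]; linarith
  set T : ℕ → ℝ → ℂ := fun p v => (Real.exp (-(ρ * v)) : ℂ) *
    ((v ^ 2 - M ^ 2 : ℝ) : ℂ) ^ (s - n + 1 - 1) * ((v + M) ^ p : ℝ) with hT
  set c : ℕ → ℂ := fun k => ((poch (1 - n / 2) k / (k.factorial : ℝ) * (2 * M) ^ k : ℝ) : ℂ)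
    with hc
  -- The full binomial power moves s - n + 1 to s - n/2. The subtracted terms carry (v + M)^{n-2-k},
  -- an honest natural power because k ≤ n - 2.
  have hsplit : ∀ v ∈ Ioi M, (Real.exp (-(ρ * v)) : ℂ) *
      ((v ^ 2 - M ^ 2 : ℝ) : ℂ) ^ (s - n + 1 - 1) * (weightLaplace (1 - n / 2) (n - 1) M v : ℂ) =
      (Real.exp (-(ρ * v)) : ℂ) * ((v ^ 2 - M ^ 2 : ℝ) : ℂ) ^ (s - n / 2 - 1) -
        ∑ k ∈ Finset.range (n - 1), c k * T (n - 2 - k) v := by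
    intro v hv
    have hv' : M < v := hv
    have hd : 0 < v ^ 2 - M ^ 2 := by nlinarith
    have hd0 : ((v ^ 2 - M ^ 2 : ℝ) : ℂ) ≠ 0 := by exact_mod_cast hd.ne'
    have hq : 0 < v + M := by linarith
    rw [weightLaplace_eq hn hM.le hv', Complex.ofReal_sub ((v ^ 2 - M ^ 2) ^ _), mul_sub,
      Complex.ofReal_sum, Finset.mul_sum, Complex.ofReal_cpow hd.le, mul_assoc,
      ← Complex.cpow_add _ _ hd0]
    congr 1
    · congr 2
      push_cast
      ring
    · refine Finset.sum_congr rfl fun k hk => ?_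
      have hk' := Finset.mem_range.mp hk
      have hp : (v + M) ^ ((n : ℝ) - 2 - k) = (v + M) ^ (n - 2 - k) := by
        rw [← Real.rpow_natCast]
        congr 1
        rw [Nat.cast_sub (by omega), Nat.cast_sub (by omega)]
        norm_num
      simp only [hT, hc]
      rw [hp, Complex.ofReal_mul _ ((v + M) ^ (n - 2 - k))]
      ring
  have hTi : ∀ k, IntegrableOn (fun v => c k * T (n - 2 - k) v) (Ioi M) := fun k =>
    (integral_sq_sub_cpow_mul_add_pow hre (n - 2 - k) hρ hM).1.const_mul _
  have hL := (laplaceKernel_eq hρ hM.le hre2 (Or.inl hM.ne')).1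
  have hSi : IntegrableOn (fun v => ∑ k ∈ Finset.range (n - 1), c k * T (n - 2 - k) v) (Ioi M) :=
    integrable_finsetSum _ fun k _ => hTi k
  have key := integral_laplaceKernel_mul (μ := volume.restrict (Ioi (0 : ℝ)))
    (S := fun β => β) (g := weight (1 - n / 2) (n - 1) M) measurable_id
    (P := weightLaplace (1 - n / 2) (n - 1) M) (s := s - n + 1) (ρ := ρ) (M := M)
    (fun v hv => (laplace_weight hα hM.le hv).1) (fun v hv => (laplace_weight hα hM.le hv).2.1)
    (fun v hv => (laplace_weight hα hM.le hv).2.2)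
    ((integrableOn_congr_fun hsplit measurableSet_Ioi).mpr (hL.sub hSi))
  refine ⟨key.1, key.2.trans ?_⟩
  rw [setIntegral_congr_fun measurableSet_Ioi hsplit, integral_sub hL hSi, laplaceKernel,
    integral_finsetSum _ fun k _ => hTi k]
  congr 1
  refine Finset.sum_congr rfl fun k hk => ?_
  have hk' := Finset.mem_range.mp hk
  have hp : ((n - 2 - k : ℕ) : ℂ) = n - 2 - k := by
    rw [Nat.cast_sub (by omega), Nat.cast_sub (by omega)]
    norm_num
  have h2M0 : ((2 * M : ℝ) : ℂ) ≠ 0 := by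
    have : 2 * M ≠ 0 := by positivity
    exact_mod_cast this
  rw [integral_const_mul, (integral_sq_sub_cpow_mul_add_pow hre (n - 2 - k) hρ hM).2, hp,
    show 2 * (s - n + 1) + ((n : ℂ) - 2 - k) = 2 * s - n - k by ring,
    show 2 * s - n - 1 = (2 * (s - n + 1) - 1 + ((n : ℂ) - 2 - k)) + k by ring,
    Complex.cpow_add _ (k : ℂ) h2M0, Complex.cpow_natCast]
  simp only [hc]
  push_cast
  ring

theorem integrandB_eq (hn : 1 ≤ n) {s : ℂ} (hs : (n : ℝ) < s.re) {m : ℤ} (hm : m ≠ 0) {ρ β : ℝ}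
    (hρ : 0 < ρ) (hβ : 0 < β) :
    integrandB n (eisCoeff s (1 - n)) m ρ β = coeffFactor s (s - n + 1) m ρ *
      (laplaceKernel (s - n + 1) (ρ + β) (2 * Real.pi * |(m : ℝ)|) *
        (weight (1 - n / 2) (n - 1) (2 * Real.pi * |(m : ℝ)|) β : ℂ)) := by
  have hβ0 : (β : ℂ) ≠ 0 := by exact_mod_cast hβ.ne'
  have hre : 1 / 2 < (s - n + 1).re := by rw [re_sub_natCast_add_one]; linarith
  have hpow : (β : ℂ) ^ (1 - n : ℂ) * ((β ^ (n - 1) : ℝ) : ℂ) = 1 := by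
    rw [Complex.ofReal_pow, ← Complex.cpow_natCast, ← Complex.cpow_add _ _ hβ0]
    push_cast [hn]
    simp
  rw [integrandB, exp_mul_seriesH, eisCoeff, if_neg hm, zero_add,
    show s + (1 - n : ℂ) = s - n + 1 by ring, poissonCoeff_eq_laplaceKernel hre (by linarith),
    coeffFactor, Complex.ofReal_mul]
  linear_combination ((ρ : ℂ) ^ s * (varphi m (s - n + 1) * (Real.pi * (4 : ℂ) ^ (1 - (s - n + 1)) *
    (Complex.Gamma (s - n + 1) ^ 2)⁻¹ *
      laplaceKernel (s - n + 1) (ρ + β) (2 * Real.pi * |(m : ℝ)|))) *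
    (weight (1 - n / 2) (n - 1) (2 * Real.pi * |(m : ℝ)|) β : ℂ)) * hpow

/-- The parameter a = ½ - κ + μ equals s - n + 1 for every k; only c = 2s - n - k varies. -/
theorem whittakerW_eq (s : ℂ) (n k : ℕ) (x : ℝ) :
    whittakerW (n / 2 - 1 - k / 2) (s - (n + 1) / 2 - k / 2) x =
      (Real.exp (-x / 2) : ℂ) * (x : ℂ) ^ (s - n / 2 - k / 2) *
        tricomiPsi (s - n + 1) (2 * s - n - k) x := by
  rw [whittakerW]
  congr 2
  · congr 1
    ring
  · ring
  · ring

/-- The factor (4π|m|ρ)^{k/2} compensates the k-dependence of the power in front of the Tricomi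
function, so all terms share one prefactor. -/
theorem remainderR_eq {s : ℂ} (hs : (n : ℝ) < s.re) {m : ℤ} (hm : m ≠ 0) {ρ : ℝ} (hρ : 0 < ρ) :
    remainderR n s m ρ = coeffFactor s (s - n + 1) m ρ *
      ∑ k ∈ Finset.range (n - 1), ((poch (1 - n / 2) k / (k.factorial : ℝ) : ℝ) : ℂ) *
          ((Real.exp (-(2 * Real.pi * |(m : ℝ)| * ρ)) : ℂ) *
            ((2 * (2 * Real.pi * |(m : ℝ)|) : ℝ) : ℂ) ^ (2 * s - n - 1) *
            Complex.Gamma (s - n + 1) *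
            tricomiPsi (s - n + 1) (2 * s - n - k) (2 * (2 * Real.pi * |(m : ℝ)|) * ρ)) := by
  have hπ := Real.pi_pos
  have hμ : 0 < |(m : ℝ)| := abs_pos.mpr (by exact_mod_cast hm)
  have hre : 0 < (s - n + 1).re := by rw [re_sub_natCast_add_one]; linarith
  have hΓ := Complex.Gamma_ne_zero_of_re_pos hre
  have hx : 0 < 4 * Real.pi * |(m : ℝ)| * ρ := by positivity
  have hlog4 : Real.log 4 = 2 * Real.log 2 := by
    rw [show (4 : ℝ) = 2 ^ 2 by norm_num, Real.log_pow]; norm_num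
  have hM2 : 2 * (2 * Real.pi * |(m : ℝ)|) = 4 * Real.pi * |(m : ℝ)| := by ring
  have hM : 0 < 4 * Real.pi * |(m : ℝ)| := by positivity
  have hlogM : Real.log (4 * Real.pi * |(m : ℝ)|) =
      2 * Real.log 2 + Real.log Real.pi + Real.log |(m : ℝ)| := by
    rw [Real.log_mul (by positivity) hμ.ne', Real.log_mul (by norm_num) hπ.ne', hlog4]
  have hlogx : Real.log (4 * Real.pi * |(m : ℝ)| * ρ) =
      2 * Real.log 2 + Real.log Real.pi + Real.log |(m : ℝ)| + Real.log ρ := by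
    rw [Real.log_mul hM.ne' hρ.ne', hlogM]
  rw [remainderR, coeffFactor, Finset.mul_sum, Finset.mul_sum]
  refine Finset.sum_congr rfl fun k _ => ?_
  rw [whittakerW_eq, hM2, show -(4 * Real.pi * |(m : ℝ)| * ρ) / 2 =
    -(2 * Real.pi * |(m : ℝ)| * ρ) by ring]
  generalize tricomiPsi (s - n + 1) (2 * s - n - k) (4 * Real.pi * |(m : ℝ)| * ρ) = Ψ
  rw [ofReal_cpow_eq_exp hx, ofReal_cpow_eq_exp hx, ofReal_cpow_eq_exp hM, ofReal_cpow_eq_exp hρ,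
    ofReal_cpow_eq_exp hρ, ofReal_cpow_eq_exp hμ, ofReal_cpow_eq_exp hπ, four_cpow_eq_exp,
    two_zpow_eq_exp, ofReal_eq_exp_log hπ, hlogx, hlogM]
  have e1 : Complex.exp ((Real.log 2 : ℂ) * (((n : ℤ) - 2 : ℤ) : ℂ)) *
      Complex.exp ((Real.log Real.pi : ℂ) * (s - n / 2)) *
      Complex.exp ((Real.log |(m : ℝ)| : ℂ) * (s - 1 - n / 2)) *
      Complex.exp ((Real.log ρ : ℂ) * ((n : ℂ) / 2)) *
      Complex.exp (((2 * Real.log 2 + Real.log Real.pi + Real.log |(m : ℝ)| + Real.log ρ : ℝ) : ℂ) *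
        ((k : ℂ) / 2)) *
      Complex.exp (((2 * Real.log 2 + Real.log Real.pi + Real.log |(m : ℝ)| + Real.log ρ : ℝ) : ℂ) *
        (s - n / 2 - k / 2)) =
      Complex.exp ((Real.log ρ : ℂ) * s) * Complex.exp (Real.log Real.pi : ℂ) *
      Complex.exp ((Real.log 2 : ℂ) * (2 * (1 - (s - n + 1)))) *
      Complex.exp (((2 * Real.log 2 + Real.log Real.pi + Real.log |(m : ℝ)| : ℝ) : ℂ) *
        (2 * s - n - 1)) := by
    simp only [← Complex.exp_add]
    congr 1
    push_cast
    ring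
  have e2 : (Complex.Gamma (s - n + 1))⁻¹ =
      (Complex.Gamma (s - n + 1) ^ 2)⁻¹ * Complex.Gamma (s - n + 1) := by field_simp
  rw [e2]
  linear_combination ((Complex.Gamma (s - n + 1) ^ 2)⁻¹ * Complex.Gamma (s - n + 1) *
    varphi m (s - n + 1) * ((poch (1 - n / 2) k / (k.factorial : ℝ) : ℝ) : ℂ) *
    (Real.exp (-(2 * Real.pi * |(m : ℝ)| * ρ)) : ℂ) * Ψ) * e1

theorem integral_integrandB (hn : 1 ≤ n) {s : ℂ} (hs : (n : ℝ) < s.re) {m : ℤ} (hm : m ≠ 0)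
    {ρ : ℝ} (hρ : 0 < ρ) :
    IntegrableOn (integrandB n (eisCoeff s (1 - n)) m ρ) (Ioi 0) ∧
    ∫ β in Ioi (0 : ℝ), integrandB n (eisCoeff s (1 - n)) m ρ β =
      (2 : ℂ) ^ ((n : ℤ) - 1) * (Real.pi : ℂ) ^ (s - n / 2) *
        (Complex.Gamma (s - n / 2) / Complex.Gamma (s - n + 1) ^ 2) * varphi m (s - n + 1) *
        ((|(m : ℝ)| : ℝ) : ℂ) ^ (s - (n + 1) / 2) * (ρ : ℂ) ^ (((n : ℂ) + 1) / 2) *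
        besselK (s - (n + 1) / 2) (2 * Real.pi * |(m : ℝ)| * ρ) - remainderR n s m ρ := by
  have hn' : (1 : ℝ) ≤ n := by exact_mod_cast hn
  have hπ := Real.pi_pos
  have hμ : 0 < |(m : ℝ)| := abs_pos.mpr (by exact_mod_cast hm)
  have hM : 0 < 2 * Real.pi * |(m : ℝ)| := by positivity
  have hre : 0 < (s - n / 2).re := by rw [re_sub_natCast_div_two]; linarith
  have hcongr : ∀ β ∈ Ioi (0 : ℝ), _ := fun β hβ => integrandB_eq hn hs hm hρ (mem_Ioi.mp hβ)
  have key := integral_laplaceKernel_mul_weight hn hs hρ hM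
  refine ⟨(integrableOn_congr_fun hcongr measurableSet_Ioi).mpr (key.1.const_mul _), ?_⟩
  rw [setIntegral_congr_fun measurableSet_Ioi hcongr, integral_const_mul, key.2, mul_sub,
    ← remainderR_eq hs hm hρ, coeffFactor, laplaceKernel_eq_besselK hre hμ hρ,
    show s - n / 2 - 1 / 2 = s - (n + 1) / 2 by ring, ofReal_cpow_eq_exp hρ,
    ofReal_cpow_eq_exp hρ, ofReal_cpow_eq_exp hμ, ofReal_cpow_eq_exp hπ, four_cpow_eq_exp,
    two_zpow_eq_exp, ofReal_eq_exp_log hπ]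
  have e1 : Complex.exp ((Real.log ρ : ℂ) * s) * Complex.exp (Real.log Real.pi : ℂ) *
      Complex.exp ((Real.log 2 : ℂ) * (2 * (1 - (s - n + 1)))) *
      Complex.exp ((Real.log 2 : ℂ) * (2 * (s - n / 2) - 1) +
        (Real.log Real.pi : ℂ) * (s - n / 2 - 1) +
        (Real.log |(m : ℝ)| : ℂ) * (s - (n + 1) / 2) - (Real.log ρ : ℂ) * (s - (n + 1) / 2)) =
      Complex.exp ((Real.log 2 : ℂ) * (((n : ℤ) - 1 : ℤ) : ℂ)) *
      Complex.exp ((Real.log Real.pi : ℂ) * (s - n / 2)) *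
      Complex.exp ((Real.log |(m : ℝ)| : ℂ) * (s - (n + 1) / 2)) *
      Complex.exp ((Real.log ρ : ℂ) * (((n : ℂ) + 1) / 2)) := by
    simp only [← Complex.exp_add]
    congr 1
    push_cast
    ring
  rw [div_eq_mul_inv _ (Complex.Gamma _ ^ 2)]
  linear_combination (varphi m (s - n + 1) * (Complex.Gamma (s - n + 1) ^ 2)⁻¹ *
    Complex.Gamma (s - n / 2) * besselK (s - (n + 1) / 2) (2 * Real.pi * |(m : ℝ)| * ρ)) * e1

end

end UnitaryEisenstein

/-! ### The theorem. -/

open UnitaryEisenstein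

theorem theorem4p1 (n : ℕ) (hn : 1 ≤ n) (s : ℂ) :
    -- the Eisenstein series `E(Z; s, 0)` and its Fourier coefficients `a_m(ρ, β)`
    (1 < s.re →
      (∀ Z : SiegelDomain n, Summable (eisTerm s 0 Z)) ∧
      (∀ m : ℤ, Summable (varphiTerm m s)) ∧
      ∃ a : ℤ → ℝ → ℝ → ℂ,
        (∀ (m : ℤ) (z : Fin n → ℂ) (ρ : ℝ) (hρ : 0 < ρ),
          a m ρ (∑ j, Complex.normSq (z j)) =
            ∫ t in (0 : ℝ)..1, eisenstein s 0 (ofCoords z t ρ hρ) * e (-(m * t))) ∧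
        (∀ Z : SiegelDomain n,
          HasSum (fun m : ℤ => a m (rho Z) (beta Z) * e (m * tt Z)) (eisenstein s 0 Z)) ∧
        ((n : ℝ) / 2 < s.re → ∀ m : ℤ, m ≠ 0 → ∀ ρ : ℝ, 0 < ρ →
          IntegrableOn (integrandA (n := n) a s m ρ) (Set.univ.pi fun _ => Set.Ioi 0) ∧
          ∫ b in Set.univ.pi (fun _ : Fin n => Set.Ioi (0 : ℝ)), integrandA a s m ρ b =
            (2 : ℂ) ^ (1 - (n : ℤ)) * (Real.pi : ℂ) ^ (s - n / 2) *
              (Complex.Gamma (s - n / 2) / Complex.Gamma s ^ 2) * varphi m s *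
              ((|(m : ℝ)| : ℝ) : ℂ) ^ (s - (n + 1) / 2) * (ρ : ℂ) ^ (((n : ℂ) + 1) / 2) *
              besselK (s - (n + 1) / 2) (2 * Real.pi * |(m : ℝ)| * ρ)) ∧
        (((n : ℝ) + 1) / 2 < s.re → ∀ ρ : ℝ, 0 < ρ →
          IntegrableOn (integrandA (n := n) a s 0 ρ) (Set.univ.pi fun _ => Set.Ioi 0) ∧
          ∫ b in Set.univ.pi (fun _ : Fin n => Set.Ioi (0 : ℝ)), integrandA a s 0 ρ b =
            (2 : ℂ) ^ (-(n : ℤ)) * (Real.sqrt Real.pi : ℂ) *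
              (Complex.Gamma (s - n / 2) * Complex.Gamma (s - (n + 1) / 2) /
                Complex.Gamma s ^ 2) *
              varphi 0 s * (ρ : ℂ) ^ ((n : ℂ) + 1 - s))) ∧
    -- the Eisenstein series `E(Z; s, 1 - n)` and its Fourier coefficients `b_m(ρ, β)`
    ((n : ℝ) < s.re →
      (∀ Z : SiegelDomain n, (2 ≤ n → Z.z ≠ 0) → Summable (eisTerm s (1 - n) Z)) ∧
      (∀ m : ℤ, Summable (varphiTerm m (s - n + 1))) ∧
      ∃ b : ℤ → ℝ → ℝ → ℂ,
        (∀ (m : ℤ) (z : Fin n → ℂ) (ρ : ℝ) (hρ : 0 < ρ), (2 ≤ n → z ≠ 0) →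
          b m ρ (∑ j, Complex.normSq (z j)) =
            ∫ t in (0 : ℝ)..1, eisenstein s (1 - n) (ofCoords z t ρ hρ) * e (-(m * t))) ∧
        (∀ Z : SiegelDomain n, (2 ≤ n → Z.z ≠ 0) →
          HasSum (fun m : ℤ => b m (rho Z) (beta Z) * e (m * tt Z)) (eisenstein s (1 - n) Z)) ∧
        (∀ m : ℤ, m ≠ 0 → ∀ ρ : ℝ, 0 < ρ →
          IntegrableOn (integrandB n b m ρ) (Set.Ioi 0) ∧
          ∫ β in Set.Ioi (0 : ℝ), integrandB n b m ρ β =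
            (2 : ℂ) ^ ((n : ℤ) - 1) * (Real.pi : ℂ) ^ (s - n / 2) *
              (Complex.Gamma (s - n / 2) / Complex.Gamma (s - n + 1) ^ 2) *
              varphi m (s - n + 1) *
              ((|(m : ℝ)| : ℝ) : ℂ) ^ (s - (n + 1) / 2) * (ρ : ℂ) ^ (((n : ℂ) + 1) / 2) *
              besselK (s - (n + 1) / 2) (2 * Real.pi * |(m : ℝ)| * ρ) -
            remainderR n s m ρ)) := by
  -- Both halves use the coefficients `eisCoeff s μ`, with κ = s + μ equal to s or s - n + 1; the
  -- hypotheses on s say exactly Re κ > 1.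
  have hadd : s + (1 - n : ℂ) = s - n + 1 := by ring
  refine ⟨fun hs => ?_, fun hs => ?_⟩
  · have hre : 1 < (s + 0).re := by simpa using hs
    refine ⟨fun Z => (hasSum_eisTerm hre Z).summable, fun m => summable_varphiTerm m hs,
      eisCoeff s 0, fun m z ρ hρ => integral_eisenstein_mul_e hre m z hρ,
      fun Z => hasSum_eisCoeff hre Z, fun hsn m hm ρ hρ => ⟨?_, ?_⟩, fun hsn ρ hρ => ⟨?_, ?_⟩⟩
    · exact (integral_integrandA hs m hρ hsn (Or.inl hm)).1
    · exact integral_integrandA_of_ne_zero hs hm hρ hsn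
    · exact (integral_integrandA hs 0 hρ (by linarith) (Or.inr hsn)).1
    · exact integral_integrandA_zero hs hρ hsn
  · have hre' : 1 < (s - n + 1).re := by
      rw [re_sub_natCast_add_one]
      linarith
    have hre : 1 < (s + (1 - n : ℂ)).re := by rwa [hadd]
    exact ⟨fun Z _ => (hasSum_eisTerm hre Z).summable, fun m => summable_varphiTerm m hre',
      eisCoeff s (1 - n), fun m z ρ hρ _ => integral_eisenstein_mul_e hre m z hρ,
      fun Z _ => hasSum_eisCoeff hre Z, fun m hm ρ hρ => integral_integrandB hn hs hm hρ⟩
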